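/- A composition is a finite (possibly empty) sequence $P=(p_1,\dots,p_m)$ of positive integers; $m$ is its width and $|P|=p_1+\cdots+p_m$ its weight. Consider the partially defined operations $$L.P=(1,p_1,\dots,p_m),\qquad U_j.P=(p_1,\dots,p_{j-1},p_j+1,p_{j+1},\dots,p_m)\quad(1\le j\le m),$$ $$V_i^r.P=(p_1,\dots,p_{i-2},\,p_{i-1}-r+1,\,r,\,p_i,\dots,p_m)\quad(2\le i\le m+1,\ r\ge 1,\ p_{i-1}-r+1\ge 2).$$ For a positive integer $d$ let $\mathfrak S^d$ be the set of all compositions, ordered by: $P\le Q$ if and only if $Q$ is obtained from $P$ by a finite sequence of operations from $\{L\}\cup\{U_j : j\ge 1\}\cup\{V_i^r : 1\le r<d\}$, where at each step the operation used is admissible, i.e. no operation of higher priority gives the same result ($L$ and the $U_j$ have the highest priority, and $V_i^r$ has higher priority than $V_j^s$ if and only if $i<j$). A saturated chain of length $n$ starting from $\alpha$ is a sequence $\gamma=(P_0=\alpha,P_1,\dots,P_n)$ in which $P_{i+1}$ covers $P_i$ for every $i$; its width is the width of its last term $P_n$. If $P_n=(p_1,\dots,p_k)$ put $v(\gamma)=x_1^{p_1}\cdots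 x_k^{p_k}$, and let $$f_k^\alpha[\mathfrak S^d](x_1,\dots,x_k)=\sum_{\gamma}v(\gamma),\qquad L_k^\alpha[\mathfrak S^d](t)=f_k^\alpha[\mathfrak S^d](t,\dots,t),$$ where the sum is over all saturated chains $\gamma$ of width $k$ in $\mathfrak S^d$ starting from $\alpha$. The denominator of a power series that is a rational function is its denominator when written in lowest terms over $\mathbb Q$, normalized to have constant term $1$. **Theorem.** Let $\alpha$ be a composition with $r$ parts, and let $k,d$ be positive integers with $r\le k$. Then the following hold. 1. $f_k^\alpha[\mathfrak S^d]$ is a rational function, and its denominator is of the form $$\prod_{\emptyset\ne S\subseteq\{1,\dots,k\}}\Bigl(1-\sum_{i\in S}x_i\Bigr)^{e(\alpha,k,d,S)}$$ with non-negative integers $e(\alpha,k,d,S)$, where $e(\alpha,k,d,\{1,\dots,k\})=1$. 2. $L_k^\alpha[\mathfrak S^d](t)$ is a rational function, and its denominator is of the form $$\prod_{i=1}^k(1-it)^{c(\alpha,k,d,i)}$$ with non-negative integers $c(\alpha,k,d,i)$, where $c(\alpha,k,d,k)=1$. 3. The coefficient of $t^n$ in $L_k^\alpha[\mathfrak S^d](t)$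 is the number of saturated chains of width $k$ and length $n-|\alpha|$ starting from $\alpha$ (and is $0$ if $n<|\alpha|$), and it is asymptotically equivalent to $Ck^n$ as $n\to\infty$ for some constant $C>0$. Likewise, the number of saturated chains of width $k$ and length $n$ starting from $\alpha$ is asymptotically equivalent to $C'k^n$ as $n\to\infty$ for some constant $C'>0$. -/

import Mathlib

/-- A composition, that is, a finite (possibly empty) sequence of positive integers, regarded as an
element of the poset `𝔖^d`; the parameter `d` only selects the order relation defined below. -/
@[ext] structure StanleyPoset (d : ℕ) where
  parts : List ℕ+

/-- The symbols `L`, `U_j` and `V_i^r`, with `i, j, r` positive integers. -/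
inductive CompOp where
  | L : CompOp
  | U (j : ℕ+) : CompOp
  | V (i r : ℕ+) : CompOp

namespace CompOp

/-- `T.Act P Q` says that the partially defined operation `T` is defined at `P`, with `T.P = Q`:
* `L.P = (1, p_1, …, p_k)`;
* `U_j.P` replaces the part `p_j` by `p_j + 1`;
* `V_i^r.P` (for `i ≥ 2`) replaces the part `p = p_{i-1}` by the two consecutive parts
  `q = p - r + 1` and `r`, and is defined when `q ≥ 2`. For `r = 1` this inserts a part `1` after
  a part `p_{i-1} ≥ 2`. -/
inductive Act : CompOp → List ℕ+ → List ℕ+ → Prop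
  | left (P : List ℕ+) : Act L P (1 :: P)
  | up (A B : List ℕ+) (p : ℕ+) :
      Act (U A.length.succPNat) (A ++ p :: B) (A ++ (p + 1) :: B)
  | split (A B : List ℕ+) (p q r : ℕ+) (hq : 2 ≤ q) (hqr : q + r = p + 1) :
      Act (V (A.length + 1).succPNat r) (A ++ p :: B) (A ++ q :: r :: B)

/-- Level of priority, a smaller number meaning a higher priority: `L` and the `U_j` come first,
then the `V_i^r`, ordered by increasing `i`. -/
def level : CompOp → ℕ
  | L => 0
  | U _ => 0
  | V i _ => i

/-- The alphabet of `𝔖^d`: `L`, all the `U_j`, and the `V_i^r` with `r < d`. -/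
def alphabet (d : ℕ) : Set CompOp :=
  {T | T = L ∨ (∃ j, T = U j) ∨ ∃ i r : ℕ+, (r : ℕ) < d ∧ T = V i r}

/-- `T` is admissible for `P` relative to the alphabet of `𝔖^d`, and `T.P = Q`: no operation of
the alphabet with higher priority gives the same result. -/
def Admissible (d : ℕ) (T : CompOp) (P Q : List ℕ+) : Prop :=
  T ∈ alphabet d ∧ T.Act P Q ∧ ∀ S ∈ alphabet d, S.level < T.level → ¬ S.Act P Q

end CompOp

namespace StanleyPoset

variable {d : ℕ}

/-- The number of parts. -/
def width (P : StanleyPoset d) : ℕ := P.parts.length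

/-- The sum of the parts. -/
def weight (P : StanleyPoset d) : ℕ := (P.parts.map PNat.val).sum

/-- `Q` is obtained from `P` by one admissible operation. -/
def Step (P Q : StanleyPoset d) : Prop := ∃ T : CompOp, T.Admissible d P.parts Q.parts

theorem Step.weight_eq {P Q : StanleyPoset d} (h : Step P Q) : Q.weight = P.weight + 1 := by
  obtain ⟨P⟩ := P
  obtain ⟨Q⟩ := Q
  obtain ⟨T, -, h, -⟩ := h
  simp only at h
  unfold weight
  cases h with
  | left => simp [add_comm]
  | up A B p => simp; ring
  | split A B p q r hq hqr =>
    have := congrArg PNat.val hqr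
    simp at this ⊢
    omega

theorem weight_le_of_reflTransGen {P Q : StanleyPoset d} (h : Relation.ReflTransGen Step P Q) :
    P = Q ∨ P.weight < Q.weight := by
  induction h with
  | refl => exact Or.inl rfl
  | tail _ hs ih =>
    have := hs.weight_eq
    rcases ih with rfl | ih <;> right <;> omega

/-- `P ≤ Q` if and only if `Q` can be obtained from `P` by a (possibly empty) sequence of admissible
operations. -/
instance : PartialOrder (StanleyPoset d) where
  le P Q := Relation.ReflTransGen Step P Q
  le_refl _ := Relation.ReflTransGen.refl
  le_trans _ _ _ h₁ h₂ := Relation.ReflTransGen.trans h₁ h₂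
  le_antisymm P Q h₁ h₂ := by
    rcases weight_le_of_reflTransGen h₁ with h | h
    · exact h
    · rcases weight_le_of_reflTransGen h₂ with h' | h'
      · exact h'.symm
      · omega

/-- The saturated chains `γ = (P_0, P_1, …, P_n)` of `𝔖^d`: each term is covered by the next one.
The length is `n` (the number of steps), `γ.head = P_0` and `γ.last = P_n`. -/
abbrev SaturatedChain (d : ℕ) := RelSeries {(P, Q) : StanleyPoset d × StanleyPoset d | P ⋖ Q}

/-- The exponent vector of `x_1^{p_1} ⋯ x_k^{p_k}`, where `P = (p_1, …, p_k)`. -/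
noncomputable def exponent (k : ℕ) (P : StanleyPoset d) : Fin k →₀ ℕ :=
  Finsupp.equivFunOnFinite.symm fun i => (P.parts.map PNat.val).getD i 0

/-- The saturated chains of width `k` (the number of parts of the last term) that start
from `α`. -/
def chains (α : StanleyPoset d) (k : ℕ) : Set (SaturatedChain d) :=
  {γ | γ.head = α ∧ γ.last.width = k}

theorem step_of_covBy {P Q : StanleyPoset d} (h : P ⋖ Q) : Step P Q := by
  obtain ⟨hlt, hno⟩ := h
  rcases Relation.ReflTransGen.cases_head hlt.le with heq | ⟨R, hs, hR⟩
  · exact absurd heq hlt.ne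
  · by_cases hRQ : R = Q
    · exact hRQ ▸ hs
    · have h1 : P < R := lt_of_le_of_ne (Relation.ReflTransGen.single hs) (by
        rintro rfl
        have := hs.weight_eq
        omega)
      exact absurd (lt_of_le_of_ne hR hRQ) (hno h1)

theorem weight_chain (γ : SaturatedChain d) (i : Fin (γ.length + 1)) :
    (γ i).weight = γ.head.weight + i := by
  induction i using Fin.induction with
  | zero => simp [RelSeries.head]
  | succ i ih =>
    have := (step_of_covBy (γ.step i)).weight_eq
    simp only [Fin.val_succ, Fin.val_castSucc] at *
    omega

theorem finite_lists {A : Type*} {S : Set A} (hS : S.Finite) (n : ℕ) :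
    {l : List A | l.length ≤ n ∧ ∀ x ∈ l, x ∈ S}.Finite := by
  have := hS.to_subtype
  refine ((List.finite_length_le S n).image (List.map Subtype.val)).subset ?_
  rintro l ⟨hl, hS⟩
  lift l to List S using hS
  exact ⟨l, (List.length_map (as := l) Subtype.val).symm.trans_le hl, rfl⟩

theorem finite_weight_le (N : ℕ) : {P : StanleyPoset d | P.weight ≤ N}.Finite := by
  refine ((finite_lists (Set.finite_Iic (⟨N + 1, Nat.succ_pos N⟩ : ℕ+)) N).image
    StanleyPoset.mk).subset ?_
  rintro ⟨l⟩ hP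
  change (l.map PNat.val).sum ≤ N at hP
  refine ⟨l, ⟨?_, fun p hp => ?_⟩, rfl⟩
  · have := List.length_le_sum_of_one_le (l.map PNat.val) (by
      intro i hi
      obtain ⟨p, -, rfl⟩ := List.mem_map.1 hi
      exact p.pos)
    rw [List.length_map] at this
    exact this.trans hP
  · have h1 : PNat.val p ≤ (l.map PNat.val).sum :=
      List.single_le_sum (by simp) _ (List.mem_map_of_mem hp)
    exact PNat.coe_le_coe _ _ |>.1 (h1.trans (hP.trans (Nat.le_succ N)))

/-- Only finitely many saturated chains start from `α` and end at a composition of weight at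
most `N`. -/
theorem finite_chains (α : StanleyPoset d) (N : ℕ) :
    {γ : SaturatedChain d | γ.head = α ∧ γ.last.weight ≤ N}.Finite := by
  refine Set.Finite.of_injOn (f := RelSeries.toList) (fun γ hγ => ?_)
    (RelSeries.toList_injective.injOn) (finite_lists (finite_weight_le (d := d) N) (N + 1))
  have hl := weight_chain γ (Fin.last _)
  have h2 := hγ.2
  rw [RelSeries.last, hl, Fin.val_last] at h2
  refine ⟨?_, fun P hP => ?_⟩
  · rw [RelSeries.length_toList]
    omega
  · obtain ⟨i, rfl⟩ := RelSeries.mem_toList.1 hP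
    have := weight_chain γ i
    have := i.is_lt
    change (γ i).weight ≤ N
    omega

/-- The generating function `f_k^α[𝔖^d]`: the sum of `x_1^{p_1} ⋯ x_k^{p_k}` over the saturated
chains of width `k` starting from `α`, where `(p_1, …, p_k)` is the last term of the chain. -/
noncomputable def genFun (α : StanleyPoset d) (k : ℕ) : MvPowerSeries (Fin k) ℚ :=
  fun m => (Nat.card {γ : SaturatedChain d // γ ∈ chains α k ∧ exponent k γ.last = m} : ℚ)

/-- The specialization `L_k^α[𝔖^d](t) = f_k^α[𝔖^d](t, …, t)`. -/
noncomputable def specialization (α : StanleyPoset d) (k : ℕ) : PowerSeries ℚ :=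
  MvPowerSeries.subst (fun _ : Fin k => (PowerSeries.X : PowerSeries ℚ)) (genFun α k)

/-- The number of saturated chains of width `k` and length `n` starting from `α`. -/
noncomputable def chainCount (α : StanleyPoset d) (k n : ℕ) : ℕ :=
  Nat.card {γ : SaturatedChain d // γ ∈ chains α k ∧ γ.length = n}

/-- The two cardinalities used above are those of finite sets. -/
theorem finite_chains_length (α : StanleyPoset d) (k n : ℕ) :
    {γ : SaturatedChain d | γ ∈ chains α k ∧ γ.length = n}.Finite := by
  refine (finite_chains α (α.weight + n)).subset ?_
  rintro γ ⟨⟨h1, -⟩, h2⟩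
  refine ⟨h1, ?_⟩
  have hl := weight_chain γ (Fin.last _)
  rw [RelSeries.last, hl, Fin.val_last, h1, h2]

theorem finite_chains_exponent (α : StanleyPoset d) (k : ℕ) (m : Fin k →₀ ℕ) :
    {γ : SaturatedChain d | γ ∈ chains α k ∧ exponent k γ.last = m}.Finite := by
  refine (finite_chains α (∑ i, m i)).subset ?_
  rintro γ ⟨⟨h1, h2⟩, rfl⟩
  refine ⟨h1, le_of_eq ?_⟩
  subst h2
  generalize γ.last = P
  rw [weight, ← Fin.sum_univ_getElem]
  refine Fintype.sum_equiv (finCongr (List.length_map _)) _ _ fun i => ?_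
  have hi : (i : ℕ) < (P.parts.map PNat.val).length := i.is_lt
  exact (List.getD_eq_getElem _ 0 hi).symm

end StanleyPoset

/-- The power series `f` is the rational function `N / D` in lowest terms, for some
polynomial `N`. -/
def MvPowerSeries.HasDenominator {σ : Type*} (f : MvPowerSeries σ ℚ) (D : MvPolynomial σ ℚ) :
    Prop :=
  D ≠ 0 ∧ ∃ N : MvPolynomial σ ℚ, IsRelPrime N D ∧ f * (D : MvPowerSeries σ ℚ) = N

/-- The one-variable power series `f` is the rational function `N / D` in lowest terms, for some
polynomial `N`. -/
def PowerSeries.HasDenominator (f : PowerSeries ℚ) (D : Polynomial ℚ) : Prop :=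
  D ≠ 0 ∧ ∃ N : Polynomial ℚ, IsRelPrime N D ∧ f * (D : PowerSeries ℚ) = N

/-!
Two different operations never give the same result: the `U_j` are told apart from the others by the
number of parts, and if a composition arises by splitting two different parts of `P`, or both by
splitting a part and by adding a part `1` on the left, then the parts in between are all `1`; but one
of these is what remains of a part that has been split, and is at least `2`
(`StanleyPoset.pairwise_disjoint_predBy`). Since moreover each step raises the weight by one, covering
relations, steps and actions of operations are the same thing. Sorting the chains by their last step
then gives the recursion `StanleyPoset.reducedGenFun_succ`,
`f_{k+1} (1 - x_1 - ⋯ - x_{k+1}) = v(α) [α has k+1 parts] + (terms linear in f_k)`.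
Each of these terms renames the variables by an injection `{1, …, k} → {1, …, k+1}`, multiplies by a
monomial and, for the `V_i^r`, removes the monomials of low degree in one variable, which
is done by iterating the operator `MvPowerSeries.shift`. All this preserves the class of quotients
whose denominators are products of factors `1 - ∑ i ∈ S, x_i` (`MvPowerSeries.SubsetRational`), and the
renaming leaves only proper subsets `S` of `{1, …, k+1}`. Hence `f_k` has the factor with all the
variables exactly once in a suitable denominator, and by induction all the others are of the
required form. As the factors are prime, common factors may be cancelled one by one
(`exists_isRelPrime_prod_pow`).

It remains to see that the factor with all the variables does not cancel. Let
`a(t) = (1 - k t) L_k(t)`. Its denominator is a product of factors `1 - i t` with `i < k`, so that it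
converges absolutely at `1 / k`; its coefficients are non-negative and not all zero by the recursion, so
`a(1 / k) > 0` (`StanleyPoset.valueAt_diagonalNumerator_pos`). Therefore the numerator of `L_k` does not
vanish at `1 / k`, and that of `f_k` not at `(1 / k, …, 1 / k)`. Finally `L_k = a(t) / (1 - k t)` shows
that the coefficient of `t ^ n` divided by `k ^ n` is a partial sum of the series `a(1 / k)`, whence the
asymptotics with `C = a(1 / k)`.
-/

/-! ### Quotients with denominators `1 - ∑ i ∈ S, x_i` -/

namespace MvPolynomial
variable {σ τ : Type*}

/-- The linear polynomial `1 - ∑ i ∈ S, x_i`. -/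
noncomputable def oneSubSum (S : Finset σ) : MvPolynomial σ ℚ := 1 - ∑ i ∈ S, X i

@[simp] lemma oneSubSum_empty : oneSubSum (∅ : Finset σ) = 1 := by simp [oneSubSum]

lemma rename_oneSubSum (e : σ ↪ τ) (S : Finset σ) :
    rename e (oneSubSum S) = oneSubSum (S.map e) := by
  simp [oneSubSum]

lemma oneSubSum_ne_zero (S : Finset σ) : oneSubSum S ≠ 0 := by
  intro h
  simpa [oneSubSum] using congrArg constantCoeff h

lemma prime_oneSubSum {S : Finset σ} (hS : S.Nonempty) : Prime (oneSubSum S) := by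
  classical
  rw [← UniqueFactorizationMonoid.irreducible_iff_prime]
  obtain ⟨a, ha⟩ := hS
  have hc : coeff (Finsupp.single a 1) (oneSubSum S) = -1 := by
    have h0 : (0 : σ →₀ ℕ) ≠ Finsupp.single a 1 := by simp [eq_comm]
    simp [oneSubSum, coeff_sum, coeff_X, coeff_one, ha, h0, Finsupp.single_left_inj]
  refine irreducible_of_totalDegree_eq_one (le_antisymm ?_ ?_) fun x hx => ?_
  · refine (totalDegree_sub _ _).trans (max_le (by simp) ?_)
    exact totalDegree_finsetSum_le fun i _ => by simp
  · have := le_totalDegree (p := oneSubSum S) (s := Finsupp.single a 1) (by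
      rw [mem_support_iff, hc]; norm_num)
    simpa using this
  · refine isUnit_of_dvd_unit (hx (Finsupp.single a 1)) ?_
    rw [hc]
    exact isUnit_one.neg

end MvPolynomial

namespace MvPowerSeries
open MvPolynomial (oneSubSum)

variable {σ τ : Type*}

/-- The power series that are obtained from polynomials by additions and by divisions by
`1 - ∑ i ∈ S, x_i` with `S ∈ 𝒮`. -/
inductive SubsetRational (𝒮 : Set (Finset σ)) : MvPowerSeries σ ℚ → Prop
  | coe (N : MvPolynomial σ ℚ) : SubsetRational 𝒮 (N : MvPowerSeries σ ℚ)
  | add {F G : MvPowerSeries σ ℚ} : SubsetRational 𝒮 F → SubsetRational 𝒮 G →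
      SubsetRational 𝒮 (F + G)
  | of_mul {S : Finset σ} {F : MvPowerSeries σ ℚ} : S ∈ 𝒮 →
      SubsetRational 𝒮 (F * (oneSubSum S : MvPolynomial σ ℚ)) → SubsetRational 𝒮 F

namespace SubsetRational

variable {𝒮 : Set (Finset σ)} {𝒯 : Set (Finset τ)} {F G : MvPowerSeries σ ℚ}

lemma coe_mul (N : MvPolynomial σ ℚ) (h : SubsetRational 𝒮 F) :
    SubsetRational 𝒮 ((N : MvPowerSeries σ ℚ) * F) := by
  induction h with
  | coe M => exact MvPolynomial.coe_mul N M ▸ coe (N * M)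
  | add _ _ h₁ h₂ => exact mul_add (N : MvPowerSeries σ ℚ) _ _ ▸ h₁.add h₂
  | of_mul hS _ ih => exact of_mul hS (by rwa [mul_assoc])

lemma sum {ι : Type*} (s : Finset ι) {f : ι → MvPowerSeries σ ℚ}
    (h : ∀ i ∈ s, SubsetRational 𝒮 (f i)) : SubsetRational 𝒮 (∑ i ∈ s, f i) :=
  Finset.sum_induction _ _ (fun _ _ => add) (MvPolynomial.coe_zero (σ := σ) (R := ℚ) ▸ coe 0) h

lemma mono {𝒮' : Set (Finset σ)} (hS : 𝒮 ⊆ 𝒮') (h : SubsetRational 𝒮 F) :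
    SubsetRational 𝒮' F := by
  induction h with
  | coe M => exact coe M
  | add _ _ h₁ h₂ => exact h₁.add h₂
  | of_mul h _ ih => exact of_mul (hS h) ih

lemma rename (e : σ ↪ τ) (he : ∀ S ∈ 𝒮, S.map e ∈ 𝒯) (h : SubsetRational 𝒮 F) :
    SubsetRational 𝒯 (MvPowerSeries.rename e F) := by
  induction h with
  | coe M => exact rename_coe (f := e) M ▸ coe _
  | add _ _ h₁ h₂ => exact map_add (MvPowerSeries.rename (R := ℚ) e) _ _ ▸ h₁.add h₂
  | of_mul hS _ ih =>
    refine of_mul (he _ hS) ?_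
    rwa [map_mul, rename_coe, MvPolynomial.rename_oneSubSum] at ih

/-- A series of the class is a quotient whose denominator is a product of the admitted factors. -/
lemma exists_mul_prod [Fintype σ] (h : SubsetRational 𝒮 F) :
    ∃ e : Finset σ → ℕ, (∀ S ∉ 𝒮, e S = 0) ∧ ∃ N : MvPolynomial σ ℚ,
      F * ((∏ S, oneSubSum S ^ e S : MvPolynomial σ ℚ) : MvPowerSeries σ ℚ) = N := by
  classical
  induction h with
  | coe N => exact ⟨0, fun _ _ => rfl, N, by simp⟩
  | add _ _ h₁ h₂ =>
    obtain ⟨e₁, he₁, N₁, h₁⟩ := h₁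
    obtain ⟨e₂, he₂, N₂, h₂⟩ := h₂
    refine ⟨e₁ + e₂, fun S hS => by simp [he₁ S hS, he₂ S hS],
      N₁ * ∏ S, oneSubSum S ^ e₂ S + N₂ * ∏ S, oneSubSum S ^ e₁ S, ?_⟩
    simp only [Pi.add_apply, pow_add, Finset.prod_mul_distrib, MvPolynomial.coe_mul,
      MvPolynomial.coe_add, ← h₁, ← h₂]
    ring
  | @of_mul S F hS _ ih =>
    obtain ⟨e, he, N, h⟩ := ih
    refine ⟨e + Pi.single S 1, fun T hT => ?_, N, ?_⟩
    · have : T ≠ S := fun h => hT (h ▸ hS)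
      simp [he T hT, this]
    · have : ∏ T, oneSubSum T ^ (e + Pi.single S 1 : Finset σ → ℕ) T =
          oneSubSum S * ∏ T, oneSubSum T ^ e T := by
        simp only [Pi.add_apply, pow_add, Finset.prod_mul_distrib]
        rw [mul_comm]
        congr 1
        rw [Finset.prod_eq_single S] <;> simp +contextual
      rw [this, MvPolynomial.coe_mul, ← mul_assoc, h]

end SubsetRational

/-- The operator that divides the monomials divisible by `x_a` by `x_a` and kills the others. -/
noncomputable def shift (a : σ) : MvPowerSeries σ ℚ →ₗ[ℚ] MvPowerSeries σ ℚ where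
  toFun F := fun m => coeff (m + Finsupp.single a 1) F
  map_add' _ _ := rfl
  map_smul' _ _ := rfl

lemma coeff_shift (a : σ) (F : MvPowerSeries σ ℚ) (m : σ →₀ ℕ) :
    coeff m (shift a F) = coeff (m + Finsupp.single a 1) F := rfl

lemma coeff_shift_iterate (a : σ) (n : ℕ) (F : MvPowerSeries σ ℚ) (m : σ →₀ ℕ) :
    coeff m ((shift a)^[n] F) = coeff (m + Finsupp.single a n) F := by
  induction n generalizing m with
  | zero => simp
  | succ n ih =>
    rw [Function.iterate_succ_apply', coeff_shift, ih, add_assoc, ← Finsupp.single_add,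
      add_comm 1 n]

lemma shift_coe (a : σ) (N : MvPolynomial σ ℚ) :
    shift a (N : MvPowerSeries σ ℚ) =
      (MvPolynomial.divMonomial N (Finsupp.single a 1) : MvPolynomial σ ℚ) := by
  ext m
  rw [coeff_shift, MvPolynomial.coeff_coe, MvPolynomial.coeff_coe, MvPolynomial.coeff_divMonomial,
    add_comm]

lemma shift_mul_X_self (a : σ) (F : MvPowerSeries σ ℚ) : shift a (F * X a) = F := by
  ext m
  rw [coeff_shift, X, coeff_add_mul_monomial, mul_one]

lemma shift_mul_X_of_ne {a b : σ} (h : b ≠ a) (F : MvPowerSeries σ ℚ) :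
    shift a (F * X b) = shift a F * X b := by
  classical
  ext m
  rw [coeff_shift, X, coeff_mul_monomial, coeff_mul_monomial, coeff_shift]
  have h1 : Finsupp.single b 1 ≤ m + Finsupp.single a 1 ↔ Finsupp.single b 1 ≤ m := by
    simp [h]
  by_cases hm : Finsupp.single b 1 ≤ m
  · rw [if_pos (h1.2 hm), if_pos hm, tsub_add_eq_add_tsub hm]
  · rw [if_neg (mt h1.1 hm), if_neg hm]

lemma coe_oneSubSum (S : Finset σ) :
    ((oneSubSum S : MvPolynomial σ ℚ) : MvPowerSeries σ ℚ) = 1 - ∑ i ∈ S, X i := by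
  rw [← MvPolynomial.coeToMvPowerSeries.ringHom_apply, oneSubSum, map_sub, map_one, map_sum]
  simp only [MvPolynomial.coeToMvPowerSeries.ringHom_apply, MvPolynomial.coe_X]

lemma shift_mul_oneSubSum [DecidableEq σ] (a : σ) (S : Finset σ) (F : MvPowerSeries σ ℚ) :
    shift a (F * (oneSubSum S : MvPolynomial σ ℚ)) =
      shift a F * (oneSubSum (S.erase a) : MvPolynomial σ ℚ) - if a ∈ S then F else 0 := by
  have key : ∀ T : Finset σ, a ∉ T → shift a (F * (oneSubSum T : MvPolynomial σ ℚ)) =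
      shift a F * (oneSubSum T : MvPolynomial σ ℚ) := by
    intro T hT
    rw [coe_oneSubSum, mul_sub, mul_sub, map_sub, mul_one, mul_one, Finset.mul_sum,
      Finset.mul_sum, map_sum]
    congr 1
    exact Finset.sum_congr rfl fun b hb => shift_mul_X_of_ne (ne_of_mem_of_not_mem hb hT) F
  split_ifs with ha
  · have : ((oneSubSum S : MvPolynomial σ ℚ) : MvPowerSeries σ ℚ) =
        ((oneSubSum (S.erase a) : MvPolynomial σ ℚ) : MvPowerSeries σ ℚ) - X a := by
      rw [coe_oneSubSum, coe_oneSubSum, ← Finset.add_sum_erase S _ ha]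
      ring
    rw [this, mul_sub, map_sub, shift_mul_X_self, key _ (Finset.notMem_erase a S)]
  · rw [Finset.erase_eq_of_notMem ha, key S ha, sub_zero]

/-- Applying `shift a` to `F * (1 - ∑ i ∈ S, x_i)` gives `shift a F * (1 - ∑ i ∈ S \ {a}, x_i)`
up to a multiple of `F`, so that the class is stable under `shift a` as soon as `𝒮` is stable
under the removal of `a`. -/
lemma SubsetRational.shift [DecidableEq σ] {𝒮 : Set (Finset σ)} {F : MvPowerSeries σ ℚ} {a : σ}
    (ha : ∀ S ∈ 𝒮, S.erase a ∈ 𝒮) (h : SubsetRational 𝒮 F) :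
    SubsetRational 𝒮 (MvPowerSeries.shift a F) := by
  induction h with
  | coe N => exact shift_coe a N ▸ coe _
  | add _ _ h₁ h₂ => exact map_add (MvPowerSeries.shift a) _ _ ▸ h₁.add h₂
  | @of_mul S F hS hF ih =>
    have hF' : SubsetRational 𝒮 F := of_mul hS hF
    rw [shift_mul_oneSubSum] at ih
    refine of_mul (ha S hS) ?_
    split_ifs at ih with haS
    · simpa using ih.add hF'
    · simpa using ih

lemma SubsetRational.shift_iterate [DecidableEq σ] {𝒮 : Set (Finset σ)} {F : MvPowerSeries σ ℚ}
    {a : σ} (ha : ∀ S ∈ 𝒮, S.erase a ∈ 𝒮) (h : SubsetRational 𝒮 F) (n : ℕ) :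
    SubsetRational 𝒮 ((MvPowerSeries.shift a)^[n] F) := by
  induction n with
  | zero => exact h
  | succ n ih => exact Function.iterate_succ_apply' (MvPowerSeries.shift a) n F ▸ ih.shift ha

/-- Inserting a new variable `x_a` with exponent `r`. -/
lemma coeff_X_pow_mul_rename_succAbove {k : ℕ} (a : Fin (k + 1)) (r : ℕ)
    (F : MvPowerSeries (Fin k) ℚ) (m : Fin (k + 1) →₀ ℕ) :
    coeff m (X a ^ r * rename a.succAboveEmb F) =
      if m a = r then coeff (m.comapDomain a.succAbove a.succAbove_right_injective.injOn) F
      else 0 := by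
  rw [X_pow_eq, coeff_monomial_mul, one_mul]
  split_ifs with h1 h2 h2
  · have : m - Finsupp.single a r = Finsupp.embDomain a.succAboveEmb
        (m.comapDomain a.succAbove a.succAbove_right_injective.injOn) := by
      ext x
      induction x using a.succAboveCases with
      | x =>
        rw [Finsupp.embDomain_of_notMem_range _ _ _ (by simp)]
        simp [h2]
      | p x =>
        have := Finsupp.embDomain_apply_self a.succAboveEmb
          (m.comapDomain a.succAbove a.succAbove_right_injective.injOn) x
        rw [Fin.coe_succAboveEmb] at this
        rw [this]
        simp
    rw [this, coeff_embDomain_rename]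
  · refine coeff_rename_eq_zero _ _ ?_
    rintro ⟨y, hy⟩
    have h3 := DFunLike.congr_fun hy a
    rw [← Finsupp.embDomain_eq_mapDomain, Finsupp.embDomain_of_notMem_range _ _ _ (by simp)] at h3
    have : r ≤ m a := by simpa using h1
    simp at h3
    omega
  · exact absurd (by simp [h2]) h1
  · rfl

/-- The operation `V_{i+2}^{s+1}` first turns an exponent `p ≥ s + 2` of `x_i` into `p - s`; on monomials
this is `shift i` applied `s + 2` times followed by multiplication by `x_i ^ 2`. -/
lemma coeff_X_sq_mul_shift_iterate {k : ℕ} (i : Fin k) (s : ℕ)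
    (F : MvPowerSeries (Fin k) ℚ) (m : Fin k →₀ ℕ) :
    coeff m (X i ^ 2 * (shift i)^[s + 2] F) =
      if 2 ≤ m i then coeff (m + Finsupp.single i s) F else 0 := by
  rw [X_pow_eq, coeff_monomial_mul, one_mul, coeff_shift_iterate]
  simp only [Finsupp.single_le_iff]
  split_ifs with h
  · congr 2
    ext x
    by_cases hx : x = i
    · subst hx; simp; omega
    · simp [Ne.symm hx]
  · rfl

end MvPowerSeries

/-! ### Chains and the operation of their last step -/

namespace StanleyPoset

variable {d : ℕ}

/-- Priorities do not affect which elements are reached by a step: among the operations with a given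
result, one of highest priority is admissible. -/
lemma step_iff_exists_act {P Q : StanleyPoset d} :
    Step P Q ↔ ∃ T ∈ CompOp.alphabet d, T.Act P.parts Q.parts := by
  refine ⟨fun ⟨T, hT, hact, _⟩ => ⟨T, hT, hact⟩, fun ⟨T, hT, hact⟩ => ?_⟩
  obtain ⟨S, ⟨hS, hSact⟩, hmin⟩ := (measure CompOp.level).wf.has_min
    {T | T ∈ CompOp.alphabet d ∧ T.Act P.parts Q.parts} ⟨T, hT, hact⟩
  exact ⟨S, hS, hSact, fun R hR hlt hRact => hmin R ⟨hR, hRact⟩ hlt⟩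

lemma weight_mono {P Q : StanleyPoset d} (h : P < Q) : P.weight < Q.weight :=
  (weight_le_of_reflTransGen h.le).resolve_left h.ne

lemma covBy_iff_step {P Q : StanleyPoset d} : P ⋖ Q ↔ Step P Q := by
  refine ⟨step_of_covBy, fun h => ⟨lt_of_le_of_ne (Relation.ReflTransGen.single h) ?_, ?_⟩⟩
  · rintro rfl
    have := h.weight_eq
    omega
  · intro R h1 h2
    have := h.weight_eq
    have := weight_mono h1
    have := weight_mono h2
    omega

/-- The compositions with `k` parts and exponent vector `m`; there is at most one. -/
def withExponent (d k : ℕ) (m : Fin k →₀ ℕ) : Set (StanleyPoset d) :=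
  {P | P.width = k ∧ exponent k P = m}

lemma exponent_apply (k : ℕ) (P : StanleyPoset d) (i : Fin k) :
    exponent k P i = (P.parts.map PNat.val).getD i 0 := rfl

lemma weight_eq_sum_exponent {k : ℕ} {P : StanleyPoset d} (h : P.width = k) :
    P.weight = ∑ i, exponent k P i := by
  subst h
  rw [weight, ← Fin.sum_univ_getElem]
  refine Fintype.sum_equiv (finCongr (List.length_map _)) _ _ fun i => ?_
  have hi : (i : ℕ) < (P.parts.map PNat.val).length := i.is_lt
  exact (List.getD_eq_getElem _ 0 hi).symm

lemma subsingleton_withExponent (k : ℕ) (m : Fin k →₀ ℕ) : (withExponent d k m).Subsingleton := by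
  rintro P ⟨hP, rfl⟩ Q ⟨hQ, h⟩
  ext1
  refine List.map_injective_iff.2 PNat.coe_injective (List.ext_getElem ?_ fun i h1 h2 => ?_)
  · simpa [width] using hP.trans hQ.symm
  · have hi : i < k := by simpa [← hP, width] using h1
    have := DFunLike.congr_fun h ⟨i, hi⟩
    rw [exponent_apply, exponent_apply, List.getD_eq_getElem _ _ h2,
      List.getD_eq_getElem _ _ h1] at this
    exact this.symm

/-- The saturated chains that start from `α` and end in `X`. -/
def chainsTo (α : StanleyPoset d) (X : Set (StanleyPoset d)) : Set (SaturatedChain d) :=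
  {γ | γ.head = α ∧ γ.last ∈ X}

lemma finite_chainsTo (α : StanleyPoset d) {X : Set (StanleyPoset d)} {N : ℕ}
    (hX : ∀ P ∈ X, P.weight ≤ N) : (chainsTo α X).Finite :=
  (finite_chains α N).subset fun _ hγ => ⟨hγ.1, hX _ hγ.2⟩

lemma genFun_eq_card_chainsTo (α : StanleyPoset d) (k : ℕ) (m : Fin k →₀ ℕ) :
    MvPowerSeries.coeff m (genFun α k) = (Nat.card (chainsTo α (withExponent d k m)) : ℚ) := by
  change (Nat.card _ : ℚ) = _
  congr 1
  exact Nat.card_congr (Equiv.subtypeEquivRight fun γ => and_assoc)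

/-- The compositions covered by some element of `X`. -/
def predecessors (X : Set (StanleyPoset d)) : Set (StanleyPoset d) :=
  {P | ∃ Q ∈ X, Step P Q}

lemma eraseLast_snoc (γ : SaturatedChain d) (Q : StanleyPoset d) (h : γ.last ⋖ Q) :
    (γ.snoc Q h).eraseLast = γ := by
  apply RelSeries.toList_injective
  rw [RelSeries.toList_eraseLast _ (by simp), RelSeries.toList_snoc, List.dropLast_concat]

/-- The chains of positive length that end at the unique element of `X` correspond, by removal of
the last term, to the chains that end at an element covered by it. -/
lemma card_chainsTo_eq_add (α : StanleyPoset d) {X : Set (StanleyPoset d)} [Decidable (α ∈ X)]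
    (hX : X.Subsingleton) :
    Nat.card (chainsTo α X) =
      (if α ∈ X then 1 else 0) + Nat.card (chainsTo α (predecessors X)) := by
  have hfin : (chainsTo α X).Finite := by
    rcases hX.eq_empty_or_singleton with rfl | ⟨Q, rfl⟩
    · exact finite_chainsTo α (N := 0) (by simp)
    · exact finite_chainsTo α (N := Q.weight) (by simp)
  rw [Nat.card_coe_set_eq, Nat.card_coe_set_eq,
    ← Set.ncard_inter_add_ncard_sdiff_eq_ncard _ {γ | γ.length = 0} hfin]
  congr 1
  · split_ifs with h
    · rw [Set.ncard_eq_one]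
      refine ⟨RelSeries.singleton _ α, Set.eq_singleton_iff_unique_mem.2
        ⟨⟨⟨rfl, h⟩, rfl⟩, ?_⟩⟩
      rintro γ ⟨⟨h1, -⟩, h2 : γ.length = 0⟩
      apply RelSeries.toList_injective
      have h3 : γ.toList.length = 1 := by rw [RelSeries.length_toList, h2]
      obtain ⟨a, ha⟩ := List.length_eq_one_iff.1 h3
      rw [RelSeries.toList_singleton, ha, ← h1, ← RelSeries.head_toList]
      simp [ha]
    · rw [Set.ncard_eq_zero (hfin.subset Set.inter_subset_left)]
      refine Set.eq_empty_of_forall_notMem ?_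
      rintro γ ⟨⟨h1, h2⟩, h3 : γ.length = 0⟩
      apply h
      have : γ.last = γ.head := by
        rw [RelSeries.last, RelSeries.head]
        congr 1
        ext
        simp [h3]
      rwa [← h1, ← this]
  · refine Set.ncard_congr (fun γ _ => γ.eraseLast) ?_ ?_ ?_
    · rintro γ ⟨⟨h1, h2⟩, h3⟩
      exact ⟨h1, γ.last, h2, step_of_covBy (γ.eraseLast_last_rel_last h3)⟩
    · rintro γ δ ⟨⟨-, h2⟩, h3⟩ ⟨⟨-, h2'⟩, h3'⟩ h
      have hl := hX h2 h2'
      apply RelSeries.toList_injective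
      have e1 := congrArg RelSeries.toList (RelSeries.snoc_self_eraseLast γ h3)
      have e2 := congrArg RelSeries.toList (RelSeries.snoc_self_eraseLast δ h3')
      rw [RelSeries.toList_snoc] at e1 e2
      rw [← e1, ← e2, h, hl]
    · rintro γ ⟨h1, Q, hQ, hs⟩
      refine ⟨γ.snoc Q (covBy_iff_step.2 hs), ⟨⟨?_, ?_⟩, ?_⟩, eraseLast_snoc _ _ _⟩
      · rw [RelSeries.head_snoc, h1]
      · rwa [RelSeries.last_snoc]
      · simp

lemma card_chainsTo_iUnion (α : StanleyPoset d) {I : Type*} [Fintype I]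
    {A : I → Set (StanleyPoset d)} (hA : Pairwise (Function.onFun Disjoint A))
    (hfin : ∀ i, (chainsTo α (A i)).Finite) :
    Nat.card (chainsTo α (⋃ i, A i)) = ∑ i, Nat.card (chainsTo α (A i)) := by
  have h1 : chainsTo α (⋃ i, A i) = ⋃ i, chainsTo α (A i) := by
    ext γ
    simp [chainsTo]
  have h2 : Pairwise (Function.onFun Disjoint fun i => chainsTo α (A i)) := by
    intro i j hij
    rw [Function.onFun, Set.disjoint_left]
    intro γ hi hj
    exact Set.disjoint_left.1 (hA hij) hi.2 hj.2
  have := fun i => (hfin i).to_subtype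
  rw [h1, Nat.card_congr (Set.unionEqSigmaOfDisjoint h2), Nat.card_sigma]

/-- Removal of the coordinate `a`. -/
noncomputable def removeCoord {k : ℕ} (a : Fin (k + 1)) (m : Fin (k + 1) →₀ ℕ) : Fin k →₀ ℕ :=
  m.comapDomain a.succAbove a.succAbove_right_injective.injOn

lemma removeCoord_apply {k : ℕ} (a : Fin (k + 1)) (m : Fin (k + 1) →₀ ℕ) (x : Fin k) :
    removeCoord a m x = m (a.succAbove x) := rfl

lemma getD_append_cons (A B : List ℕ+) (p : ℕ+) (x : ℕ) :
    ((A ++ p :: B).map PNat.val).getD x 0 =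
      if x < A.length then (A.map PNat.val).getD x 0
      else if x = A.length then (p : ℕ) else (B.map PNat.val).getD (x - A.length - 1) 0 := by
  rw [List.map_append]
  split_ifs with h1 h2
  · rw [List.getD_append _ _ _ _ (by simpa using h1)]
  · rw [List.getD_append_right _ _ _ _ (by simp [h2])]
    simp [h2]
  · rw [List.getD_append_right _ _ _ _ (by simpa using h1)]
    obtain ⟨y, rfl⟩ : ∃ y, x = A.length + 1 + y := ⟨x - A.length - 1, by omega⟩
    have e1 : A.length + 1 + y - (A.map PNat.val).length = y + 1 := by simp; omega
    have e2 : A.length + 1 + y - A.length - 1 = y := by omega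
    rw [e1, e2, List.map_cons, List.getD_cons_succ]

lemma exists_eq_append_cons {l : List ℕ+} {j : ℕ} (h : j < l.length) :
    ∃ A B p, l = A ++ p :: B ∧ A.length = j :=
  ⟨l.take j, l.drop (j + 1), l[j], by simp, by simp; omega⟩

lemma mem_predecessors_up {k : ℕ} {m : Fin k →₀ ℕ} {P : StanleyPoset d} {j : Fin k} :
    (∃ Q ∈ withExponent d k m, (CompOp.U (Nat.succPNat j)).Act P.parts Q.parts) ↔
      1 ≤ m j ∧ P ∈ withExponent d k (m - Finsupp.single j 1) := by
  constructor
  · rintro ⟨⟨Q⟩, ⟨hQ, rfl⟩, h⟩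
    obtain ⟨P⟩ := P
    have hQ' : Q.length = k := hQ
    dsimp only at h
    generalize hj : Nat.succPNat j = j' at h
    rcases h with _ | ⟨A, B, p⟩
    have hj' : A.length = j := (Nat.succPNat_injective hj).symm
    refine ⟨?_, ?_, ?_⟩
    · rw [exponent_apply]
      dsimp only
      rw [getD_append_cons]
      simp [hj']
    · rw [← hQ']
      simp [width]
    · ext x
      rw [Finsupp.tsub_apply, exponent_apply, exponent_apply]
      dsimp only
      rw [getD_append_cons, getD_append_cons, hj', Finsupp.single_apply]
      by_cases hx : j = x
      · subst hx; simp
      · have : (x : ℕ) ≠ j := fun h => hx (Fin.ext h.symm)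
        simp [this, hx]
  · rintro ⟨h1, hP, hPm⟩
    obtain ⟨P⟩ := P
    have hP' : P.length = k := hP
    obtain ⟨A, B, p, rfl, hA⟩ := exists_eq_append_cons (l := P) (j := j) (by omega)
    refine ⟨⟨A ++ (p + 1) :: B⟩, ⟨?_, ?_⟩, hA ▸ CompOp.Act.up A B p⟩
    · rw [← hP']
      simp [width]
    · ext x
      have h2 := DFunLike.congr_fun hPm x
      rw [Finsupp.tsub_apply, exponent_apply] at h2
      rw [exponent_apply]
      dsimp only at h2 ⊢
      rw [getD_append_cons, hA, Finsupp.single_apply] at h2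
      rw [getD_append_cons, hA]
      by_cases hx : j = x
      · subst hx
        simp at h2 ⊢
        omega
      · have : (x : ℕ) ≠ j := fun h => hx (Fin.ext h.symm)
        simpa [this, hx] using h2

lemma mem_predecessors_left {k : ℕ} {m : Fin (k + 1) →₀ ℕ} {P : StanleyPoset d} :
    (∃ Q ∈ withExponent d (k + 1) m, CompOp.L.Act P.parts Q.parts) ↔
      m 0 = 1 ∧ P ∈ withExponent d k (removeCoord 0 m) := by
  constructor
  · rintro ⟨⟨Q⟩, ⟨hQ, rfl⟩, h⟩
    obtain ⟨P⟩ := P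
    have hQ' : Q.length = k + 1 := hQ
    dsimp only at h
    rcases h with ⟨_⟩
    refine ⟨rfl, ?_, ?_⟩
    · simpa [width] using hQ'
    · ext x
      rw [removeCoord_apply, exponent_apply, exponent_apply]
      simp
  · rintro ⟨h1, hP, hPm⟩
    refine ⟨⟨1 :: P.parts⟩, ⟨?_, ?_⟩, CompOp.Act.left _⟩
    · rw [← hP]
      simp [width]
    · ext x
      rw [exponent_apply]
      induction x using Fin.cases with
      | zero => simp [h1]
      | succ x =>
        have h2 := DFunLike.congr_fun hPm x
        rw [removeCoord_apply, exponent_apply, Fin.zero_succAbove] at h2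
        simp [← h2]

lemma val_succ_succAbove {k : ℕ} (i x : Fin k) :
    (i.succ.succAbove x : ℕ) = if (x : ℕ) ≤ i then (x : ℕ) else x + 1 := by
  rw [Fin.succAbove]
  have h : x.castSucc < i.succ ↔ (x : ℕ) ≤ i := by
    rw [Fin.lt_def, Fin.val_castSucc, Fin.val_succ, Nat.lt_succ_iff]
  simp only [h]
  split_ifs <;> rfl

lemma getD_append_cons_cons (A B : List ℕ+) (q r : ℕ+) (x : ℕ) :
    ((A ++ q :: r :: B).map PNat.val).getD x 0 =
      if x < A.length then (A.map PNat.val).getD x 0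
      else if x = A.length then (q : ℕ) else if x = A.length + 1 then (r : ℕ)
      else (B.map PNat.val).getD (x - A.length - 2) 0 := by
  rw [getD_append_cons]
  split_ifs with h1 h2 h3
  · rfl
  · rfl
  · simp [h3]
  · obtain ⟨y, rfl⟩ : ∃ y, x = A.length + 2 + y := ⟨x - A.length - 2, by omega⟩
    have e1 : A.length + 2 + y - A.length - 1 = y + 1 := by omega
    have e2 : A.length + 2 + y - A.length - 2 = y := by omega
    rw [e1, e2, List.map_cons, List.getD_cons_succ]

/-- Operations are indexed from `1` and coordinates from `0`: the operation `V_{i+2}^{s+1}` splits the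
part with coordinate `i` and inserts the part `s + 1` with coordinate `i + 1`. -/
lemma mem_predecessors_split {k : ℕ} {m : Fin (k + 1) →₀ ℕ} {P : StanleyPoset d} {i : Fin k}
    {s : ℕ} :
    (∃ Q ∈ withExponent d (k + 1) m,
        (CompOp.V (Nat.succPNat (i + 1)) (Nat.succPNat s)).Act P.parts Q.parts) ↔
      m i.succ = s + 1 ∧ 2 ≤ m i.castSucc ∧
        P ∈ withExponent d k (removeCoord i.succ m + Finsupp.single i s) := by
  constructor
  · rintro ⟨⟨Q⟩, ⟨hQ, rfl⟩, h⟩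
    obtain ⟨P⟩ := P
    have hQ' : Q.length = k + 1 := hQ
    dsimp only at h
    generalize hi : Nat.succPNat (i + 1) = i' at h
    generalize hr : Nat.succPNat s = r at h
    rcases h with _ | _ | ⟨A, B, p, q, _, hq, hqr⟩
    have hi' : A.length = i := by
      have := Nat.succPNat_injective hi
      omega
    have hr' : (r : ℕ) = s + 1 := by rw [← hr]; rfl
    have hqr' : (q : ℕ) + r = p + 1 := congrArg PNat.val hqr
    refine ⟨?_, ?_, ?_, ?_⟩
    · rw [exponent_apply]
      dsimp only
      rw [getD_append_cons_cons]
      simp [hi', hr']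
    · rw [exponent_apply]
      dsimp only
      rw [getD_append_cons_cons]
      simpa [hi'] using (PNat.coe_le_coe _ _).2 hq
    · simp at hQ' ⊢
      simp [width]
      omega
    · ext x
      rw [Finsupp.add_apply, removeCoord_apply, exponent_apply, exponent_apply]
      dsimp only
      rw [getD_append_cons, getD_append_cons_cons, hi', Finsupp.single_apply,
        val_succ_succAbove]
      rcases lt_trichotomy (x : ℕ) i with hx | hx | hx
      · have : i ≠ x := fun h => hx.ne (by rw [h])
        simp [hx, hx.le, this]
      · have : i = x := Fin.ext hx.symm
        simp [this]
        omega
      · have h1 : i ≠ x := fun h => hx.ne (by rw [h])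
        have h2 : ¬ (x : ℕ) < i := by omega
        have h3 : ¬ (x : ℕ) ≤ i := by omega
        have h4 : (x : ℕ) ≠ i := by omega
        have h5 : ¬ (x : ℕ) + 1 < i := by omega
        have h6 : (x : ℕ) + 1 ≠ i := by omega
        rw [if_neg h2, if_neg h4, if_neg h3, if_neg h5, if_neg h6, if_neg (by omega),
          if_neg h1, add_zero]
        congr 1
        omega
  · rintro ⟨h1, h2, hP, hPm⟩
    obtain ⟨P⟩ := P
    have hP' : P.length = k := hP
    obtain ⟨A, B, p, rfl, hA⟩ := exists_eq_append_cons (l := P) (j := i) (by omega)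
    have key : ∀ x : Fin k, ((A ++ p :: B).map PNat.val).getD x 0 =
        m (i.succ.succAbove x) + (Finsupp.single i s) x := fun x => DFunLike.congr_fun hPm x
    have hp : (p : ℕ) = m i.castSucc + s := by
      have := key i
      rw [getD_append_cons] at this
      simpa [hA] using this
    obtain ⟨q, hq⟩ : ∃ q : ℕ+, (q : ℕ) = m i.castSucc := ⟨⟨m i.castSucc, by omega⟩, rfl⟩
    refine ⟨⟨A ++ q :: Nat.succPNat s :: B⟩, ⟨?_, ?_⟩, ?_⟩
    · simp at hP'
      simp [width]
      omega
    · ext x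
      rw [exponent_apply]
      dsimp only
      rw [getD_append_cons_cons, hA]
      induction x using i.succ.succAboveCases with
      | x => simp [h1]
      | p x =>
        have h3 := key x
        rw [getD_append_cons, hA, Finsupp.single_apply] at h3
        have h7 := val_succ_succAbove i x
        rcases lt_trichotomy (x : ℕ) i with hx | hx | hx
        · have : i ≠ x := fun h => hx.ne (by rw [h])
          rw [if_pos hx.le] at h7
          rw [if_pos hx, if_neg this, add_zero] at h3
          rw [h7, if_pos hx, h3]
        · have hx' : i = x := Fin.ext hx.symm
          subst hx'
          simp [hq]
        · have h1 : i ≠ x := fun h => hx.ne (by rw [h])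
          rw [if_neg (by omega)] at h7
          rw [if_neg (by omega), if_neg (by omega), if_neg h1, add_zero] at h3
          rw [h7, if_neg (by omega), if_neg (by omega), if_neg (by omega), ← h3]
          congr 1
          omega
    · dsimp only
      rw [← hA]
      refine CompOp.Act.split A B p _ _ (PNat.coe_le_coe _ _ |>.1 (hq ▸ h2)) (PNat.eq ?_)
      simp [hp, hq]
      omega

/-- The possible predecessors of the composition with exponent vector `m`: those by an operation
`U`, by `L`, and by a `V_{i+2}^{s+1}`. -/
def predBy {k : ℕ} (d : ℕ) (m : Fin (k + 1) →₀ ℕ) :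
    Fin (k + 1) ⊕ Unit ⊕ Fin k × Fin (d - 1) → Set (StanleyPoset d)
  | .inl j => {P | 1 ≤ m j ∧ P ∈ withExponent d (k + 1) (m - Finsupp.single j 1)}
  | .inr (.inl _) => {P | m 0 = 1 ∧ P ∈ withExponent d k (removeCoord 0 m)}
  | .inr (.inr (i, s)) => {P | (m i.succ = s + 1 ∧ 2 ≤ m i.castSucc) ∧
      P ∈ withExponent d k (removeCoord i.succ m + Finsupp.single i (s : ℕ))}

lemma predecessors_withExponent {k : ℕ} (m : Fin (k + 1) →₀ ℕ) :
    predecessors (withExponent d (k + 1) m) = ⋃ o, predBy d m o := by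
  ext P
  simp only [predecessors, Set.mem_iUnion, Set.mem_ofPred_eq, step_iff_exists_act]
  constructor
  · rintro ⟨Q, hQ, T, hT, hact⟩
    have hw : Q.parts.length = k + 1 := hQ.1
    rcases hT with rfl | ⟨j, rfl⟩ | ⟨i, r, hr, rfl⟩
    · exact ⟨.inr (.inl ()), mem_predecessors_left.1 ⟨Q, hQ, hact⟩⟩
    · have hj : ∃ j' : Fin (k + 1), j = Nat.succPNat j' := by
        obtain ⟨P⟩ := P
        obtain ⟨Q⟩ := Q
        rcases hact with _ | ⟨A, B, p⟩
        exact ⟨⟨A.length, by simp at hw; omega⟩, rfl⟩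
      obtain ⟨j, rfl⟩ := hj
      exact ⟨.inl j, mem_predecessors_up.1 ⟨Q, hQ, hact⟩⟩
    · have hi : ∃ i' : Fin k, i = Nat.succPNat (i' + 1) := by
        obtain ⟨P⟩ := P
        obtain ⟨Q⟩ := Q
        rcases hact with _ | _ | ⟨A, B, p, q, r, hq, hqr⟩
        exact ⟨⟨A.length, by simp at hw; omega⟩, rfl⟩
      obtain ⟨i, rfl⟩ := hi
      obtain ⟨s, rfl⟩ : ∃ s, r = Nat.succPNat s := ⟨r.natPred, (PNat.succPNat_natPred r).symm⟩
      have hs : s < d - 1 := by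
        rw [Nat.succPNat_coe] at hr
        omega
      have := mem_predecessors_split.1 ⟨Q, hQ, hact⟩
      exact ⟨.inr (.inr (i, ⟨s, hs⟩)), ⟨this.1, this.2.1⟩, this.2.2⟩
  · rintro ⟨j | _ | ⟨i, s⟩, h⟩
    · obtain ⟨Q, hQ, hact⟩ := mem_predecessors_up.2 h
      exact ⟨Q, hQ, _, .inr (.inl ⟨_, rfl⟩), hact⟩
    · obtain ⟨Q, hQ, hact⟩ := mem_predecessors_left.2 h
      exact ⟨Q, hQ, _, .inl rfl, hact⟩
    · obtain ⟨Q, hQ, hact⟩ := mem_predecessors_split.2 ⟨h.1.1, h.1.2, h.2⟩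
      refine ⟨Q, hQ, _, .inr (.inr ⟨_, _, ?_, rfl⟩), hact⟩
      have := s.is_lt
      rw [Nat.succPNat_coe]
      omega

/-- If the same composition is obtained from `P` by `V_{i+2}^{s+1}` and by a `V_{i'+2}^{s'+1}` with
`i < i'`, then all its parts between the one inserted first and the one split second are equal
to `1`; but a part that has been split is at least `2`. -/
lemma disjoint_split_split {k : ℕ} {m : Fin (k + 1) →₀ ℕ} {P : StanleyPoset d} {i i' : Fin k}
    {s s' : ℕ} (hii : i < i') (h1 : m i.succ = s + 1) (h2 : 2 ≤ m i'.castSucc)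
    (h : P ∈ withExponent d k (removeCoord i.succ m + Finsupp.single i s))
    (h' : P ∈ withExponent d k (removeCoord i'.succ m + Finsupp.single i' s')) : False := by
  have key := fun x => DFunLike.congr_fun (h.2.symm.trans h'.2) x
  simp only [Finsupp.add_apply, removeCoord_apply] at key
  have ones : ∀ n : ℕ, ∀ hn : i.val + 1 + n ≤ i', m ⟨i.val + 1 + n, by omega⟩ = 1 := by
    intro n
    induction n with
    | zero =>
      intro _
      have hk := key i
      have e1 : i.succ.succAbove i = i.castSucc := by simp
      have e2 : i'.succ.succAbove i = i.castSucc := by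
        ext; rw [val_succ_succAbove, if_pos (Fin.le_def.1 hii.le)]; rfl
      rw [e1, e2] at hk
      simp [hii.ne'] at hk
      have : m i.succ = 1 := by omega
      exact this
    | succ n ih =>
      intro hn
      have hk := key ⟨i.val + 1 + n, by omega⟩
      have e1 : i.succ.succAbove ⟨i.val + 1 + n, by omega⟩ = ⟨i.val + 1 + (n + 1), by omega⟩ := by
        ext; rw [val_succ_succAbove, if_neg (by simp; omega)]; simp; omega
      have e2 : i'.succ.succAbove ⟨i.val + 1 + n, by omega⟩ = ⟨i.val + 1 + n, by omega⟩ := by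
        ext; rw [val_succ_succAbove, if_pos (by simp; omega)]
      have n1 : i ≠ ⟨i.val + 1 + n, by omega⟩ := fun h => by
        have := congrArg Fin.val h
        simp at this
        omega
      have n2 : i' ≠ ⟨i.val + 1 + n, by omega⟩ := fun h => by
        have := congrArg Fin.val h
        simp at this
        omega
      rw [e1, e2, Finsupp.single_eq_of_ne' n1, Finsupp.single_eq_of_ne' n2, add_zero, add_zero,
        ih (by omega)] at hk
      exact hk
  have hlt : (i : ℕ) < i' := hii
  have := ones (i' - i - 1) (by omega)
  have e : (⟨i.val + 1 + (i'.val - i.val - 1), by omega⟩ : Fin (k + 1)) = i'.castSucc := by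
    ext; simp; omega
  rw [e] at this
  omega

lemma disjoint_left_split {k : ℕ} {m : Fin (k + 1) →₀ ℕ} {P : StanleyPoset d} {i : Fin k}
    {s : ℕ} (h1 : m 0 = 1) (h2 : 2 ≤ m i.castSucc)
    (h : P ∈ withExponent d k (removeCoord 0 m))
    (h' : P ∈ withExponent d k (removeCoord i.succ m + Finsupp.single i s)) : False := by
  have key := fun x => DFunLike.congr_fun (h.2.symm.trans h'.2) x
  simp only [Finsupp.add_apply, removeCoord_apply, Fin.zero_succAbove] at key
  have ones : ∀ n : ℕ, ∀ hn : n ≤ i, m ⟨n, by omega⟩ = 1 := by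
    intro n
    induction n with
    | zero => exact fun _ => h1
    | succ n ih =>
      intro hn
      have hk := key ⟨n, by omega⟩
      have e2 : i.succ.succAbove ⟨n, by omega⟩ = ⟨n, by omega⟩ := by
        ext; rw [val_succ_succAbove, if_pos (by simp; omega)]
      have n2 : i ≠ ⟨n, by omega⟩ := fun h => by
        have := congrArg Fin.val h
        simp at this
        omega
      rw [e2, Finsupp.single_eq_of_ne' n2, add_zero, ih (by omega)] at hk
      exact hk
  have : m i.castSucc = 1 := ones i le_rfl
  omega

/-- Different operations never give the same result. -/
lemma pairwise_disjoint_predBy {k : ℕ} (m : Fin (k + 1) →₀ ℕ) :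
    Pairwise (Function.onFun Disjoint (predBy d m)) := by
  have hw : ∀ {P : StanleyPoset d} {m' : Fin (k + 1) →₀ ℕ} {m'' : Fin k →₀ ℕ},
      P ∈ withExponent d (k + 1) m' → P ∈ withExponent d k m'' → False := by
    intro P m' m'' h1 h2
    have := h1.1.symm.trans h2.1
    omega
  intro o o' hoo
  rw [Function.onFun, Set.disjoint_left]
  intro P h h'
  rcases o with j | _ | ⟨i, s⟩ <;> rcases o' with j' | _ | ⟨i', s'⟩
  · refine hoo (congrArg Sum.inl ?_)
    by_contra hne
    have := DFunLike.congr_fun (h.2.2.symm.trans h'.2.2) j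
    have h1 : 1 ≤ m j := h.1
    rw [Finsupp.tsub_apply, Finsupp.tsub_apply, Finsupp.single_eq_same,
      Finsupp.single_eq_of_ne hne] at this
    omega
  · exact hw h.2 h'.2
  · exact hw h.2 h'.2
  · exact hw h'.2 h.2
  · exact hoo rfl
  · exact disjoint_left_split h.1 h'.1.2 h.2 h'.2
  · exact hw h'.2 h.2
  · exact disjoint_left_split h'.1 h.1.2 h'.2 h.2
  · rcases lt_trichotomy i i' with hi | rfl | hi
    · exact disjoint_split_split hi h.1.1 h'.1.2 h.2 h'.2
    · have : s = s' := by
        ext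
        have := h.1.1.symm.trans h'.1.1
        omega
      exact hoo (by rw [this])
    · exact disjoint_split_split hi h'.1.1 h.1.2 h'.2 h.2

end StanleyPoset

/-! ### Reduction to lowest terms -/

/-- If `f` is a quotient whose denominator is a product of powers of the primes `l i`, in which
`l u` occurs exactly once and can never be cancelled, then this also holds for the quotient in lowest
terms. -/
lemma exists_isRelPrime_prod_pow {R A I : Type*} [CommRing R] [IsDomain R] [DecompositionMonoid R]
    [CommRing A] [NoZeroDivisors A] {φ : R →+* A} (hφ : Function.Injective φ) {s : Finset I} {l : I → R}
    (hl : ∀ i ∈ s, Prime (l i)) {u : I} {f : A}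
    (h : ∃ e : I → ℕ, e u = 1 ∧ ∃ N, f * φ (∏ i ∈ s, l i ^ e i) = φ N)
    (hu : ∀ (e : I → ℕ) (N : R), e u = 1 → f * φ (∏ i ∈ s, l i ^ e i) = φ N → ¬ l u ∣ N) :
    ∃ e : I → ℕ, e u = 1 ∧ ∃ N, IsRelPrime N (∏ i ∈ s, l i ^ e i) ∧
      f * φ (∏ i ∈ s, l i ^ e i) = φ N := by
  classical
  obtain ⟨e, he, N, hN⟩ := h
  induction hn : ∑ i ∈ s, e i using Nat.strong_induction_on generalizing e N with
  | h n ih =>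
    by_cases H : ∃ i ∈ s, e i ≠ 0 ∧ l i ∣ N
    · obtain ⟨i, hi, hei, M, rfl⟩ := H
      have hiu : u ≠ i := by
        rintro rfl
        exact hu e _ he hN ⟨M, rfl⟩
      set e' := Function.update e i (e i - 1) with he'
      have hoff : ∀ j ∈ s.erase i, e' j = e j := fun j hj => by
        rw [he', Function.update_of_ne (Finset.ne_of_mem_erase hj)]
      have hprod : ∏ j ∈ s, l j ^ e j = l i * ∏ j ∈ s, l j ^ e' j := by
        rw [← Finset.mul_prod_erase s _ hi, ← Finset.mul_prod_erase s (fun j => l j ^ e' j) hi,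
          ← mul_assoc]
        congr 1
        · rw [he', Function.update_self, ← pow_succ']
          congr 1
          omega
        · exact Finset.prod_congr rfl fun j hj => by rw [hoff j hj]
      have hsum : ∑ j ∈ s, e' j < n := by
        have h₁ : e i + ∑ j ∈ s.erase i, e j = ∑ j ∈ s, e j := Finset.add_sum_erase s e hi
        have h₂ : e' i + ∑ j ∈ s.erase i, e' j = ∑ j ∈ s, e' j := Finset.add_sum_erase s e' hi
        have h₃ : ∑ j ∈ s.erase i, e' j = ∑ j ∈ s.erase i, e j := Finset.sum_congr rfl hoff
        have h₄ : e' i = e i - 1 := by rw [he', Function.update_self]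
        omega
      refine ih _ hsum e' ?_ M ?_ rfl
      · rw [he', Function.update_of_ne hiu, he]
      · have h0 : φ (l i) ≠ 0 := by
          rw [Ne, map_eq_zero_iff φ hφ]
          exact (hl i hi).ne_zero
        apply mul_left_cancel₀ h0
        rw [← map_mul, ← hN, hprod, map_mul]
        ring
    · push Not at H
      refine ⟨e, he, N, IsRelPrime.prod_right fun i hi => ?_, hN⟩
      rcases Nat.eq_zero_or_pos (e i) with h0 | h0
      · rw [h0, pow_zero]
        exact isRelPrime_one_right
      · exact IsRelPrime.pow_right
          (((hl i hi).irreducible.isRelPrime_iff_not_dvd).2 (H i hi h0.ne')).symm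

/-! ### Values of power series -/

namespace PowerSeries

/-- Absolute convergence at the real number `z`. -/
def AbsConvergesAt (z : ℝ) (F : PowerSeries ℚ) : Prop :=
  Summable fun n => ‖((coeff n F : ℚ) : ℝ) * z ^ n‖

/-- The value at the real number `z`; meaningful when the series converges there. -/
noncomputable def valueAt (z : ℝ) (F : PowerSeries ℚ) : ℝ :=
  ∑' n, ((coeff n F : ℚ) : ℝ) * z ^ n

lemma coeff_mul_mul_pow (z : ℝ) (F G : PowerSeries ℚ) (n : ℕ) :
    ((coeff n (F * G) : ℚ) : ℝ) * z ^ n = ∑ p ∈ Finset.HasAntidiagonal.antidiagonal n,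
      (((coeff p.1 F : ℚ) : ℝ) * z ^ p.1) * (((coeff p.2 G : ℚ) : ℝ) * z ^ p.2) := by
  rw [coeff_mul, Rat.cast_sum, Finset.sum_mul]
  refine Finset.sum_congr rfl fun p hp => ?_
  rw [← Finset.HasAntidiagonal.mem_antidiagonal.1 hp, pow_add]
  push_cast
  ring

lemma AbsConvergesAt.mul {z : ℝ} {F G : PowerSeries ℚ} (hF : AbsConvergesAt z F)
    (hG : AbsConvergesAt z G) : AbsConvergesAt z (F * G) := by
  refine (summable_norm_sum_mul_antidiagonal_of_summable_norm hF hG).congr fun n => ?_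
  rw [coeff_mul_mul_pow]

lemma valueAt_mul {z : ℝ} {F G : PowerSeries ℚ} (hF : AbsConvergesAt z F)
    (hG : AbsConvergesAt z G) : valueAt z (F * G) = valueAt z F * valueAt z G := by
  refine Eq.trans ?_ (tsum_mul_tsum_eq_tsum_sum_antidiagonal_of_summable_norm hF hG).symm
  exact tsum_congr fun n => coeff_mul_mul_pow z F G n

lemma absConvergesAt_coe (z : ℝ) (N : Polynomial ℚ) : AbsConvergesAt z (N : PowerSeries ℚ) := by
  refine summable_of_ne_finset_zero (s := Finset.range (N.natDegree + 1)) fun n hn => ?_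
  rw [Polynomial.coeff_coe, Polynomial.coeff_eq_zero_of_natDegree_lt (by simpa using hn)]
  simp

lemma valueAt_coe (z : ℝ) (N : Polynomial ℚ) :
    valueAt z (N : PowerSeries ℚ) = Polynomial.aeval z N := by
  rw [valueAt, Polynomial.aeval_eq_sum_range,
    tsum_eq_sum (s := Finset.range (N.natDegree + 1)) fun n hn => ?_]
  · simp [Polynomial.coeff_coe, Algebra.smul_def]
  · rw [Polynomial.coeff_coe, Polynomial.coeff_eq_zero_of_natDegree_lt (by simpa using hn)]
    simp

lemma one_sub_C_mul_X_mul_mk (c : ℚ) :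
    ((1 - Polynomial.C c * Polynomial.X : Polynomial ℚ) : PowerSeries ℚ) * mk (fun n => c ^ n)
      = 1 := by
  ext n
  rw [Polynomial.coe_sub, Polynomial.coe_mul, Polynomial.coe_C, Polynomial.coe_X,
    Polynomial.coe_one, sub_mul, one_mul, map_sub, mul_assoc, coeff_C_mul]
  cases n with
  | zero => simp
  | succ n => simp [coeff_succ_X_mul, coeff_one, pow_succ']

lemma eq_mul_mk_of_mul_eq {c : ℚ} {F G : PowerSeries ℚ}
    (h : F * ((1 - Polynomial.C c * Polynomial.X : Polynomial ℚ) : PowerSeries ℚ) = G) :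
    F = G * mk (fun n => c ^ n) := by
  rw [← h, mul_assoc, one_sub_C_mul_X_mul_mk, mul_one]

lemma AbsConvergesAt.of_mul_one_sub {z : ℝ} {c : ℚ} (hc : ‖(c : ℝ) * z‖ < 1) {F : PowerSeries ℚ}
    (h : AbsConvergesAt z
      (F * ((1 - Polynomial.C c * Polynomial.X : Polynomial ℚ) : PowerSeries ℚ))) :
    AbsConvergesAt z F := by
  rw [eq_mul_mk_of_mul_eq (F := F) rfl]
  refine h.mul ?_
  unfold AbsConvergesAt
  simp only [coeff_mk, Rat.cast_pow, ← mul_pow, norm_pow]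
  exact summable_geometric_of_lt_one (norm_nonneg _) hc

lemma AbsConvergesAt.of_mul_prod {I : Type*} {z : ℝ} (s : Finset I) (c : I → ℚ) (e : I → ℕ)
    (hc : ∀ i ∈ s, ‖(c i : ℝ) * z‖ < 1) {F : PowerSeries ℚ}
    (h : AbsConvergesAt z (F * ((∏ i ∈ s, (1 - Polynomial.C (c i) * Polynomial.X) ^ e i :
      Polynomial ℚ) : PowerSeries ℚ))) :
    AbsConvergesAt z F := by
  -- The property that convergence of `F * q` implies that of `F`, for all `F`, is multiplicative.
  let good (q : Polynomial ℚ) : Prop :=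
    ∀ F : PowerSeries ℚ, AbsConvergesAt z (F * (q : PowerSeries ℚ)) → AbsConvergesAt z F
  have hone : good 1 := fun F hF => by simpa using hF
  have hmul : ∀ p q, good p → good q → good (p * q) := fun p q hp hq F hF =>
    hp F (hq _ (by rwa [mul_assoc, ← Polynomial.coe_mul]))
  have hpow : ∀ q, good q → ∀ n : ℕ, good (q ^ n) := fun q hq n => by
    induction n with
    | zero => rwa [pow_zero]
    | succ n ih => exact pow_succ q n ▸ hmul _ _ ih hq
  exact Finset.prod_induction _ good hmul hone
    (fun i hi => hpow _ (fun _ => AbsConvergesAt.of_mul_one_sub (hc i hi)) _) F h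

/-- If `F = G / (1 - c t)` and `G` converges at `1 / c`, the coefficients of `F` grow like
`G(1 / c) c ^ n`. -/
lemma tendsto_coeff_div_pow {c : ℚ} (hc : 0 < c) {F G : PowerSeries ℚ}
    (h : F * ((1 - Polynomial.C c * Polynomial.X : Polynomial ℚ) : PowerSeries ℚ) = G)
    (hG : AbsConvergesAt (c : ℝ)⁻¹ G) :
    Filter.Tendsto (fun n => ((coeff n F : ℚ) : ℝ) / (c : ℝ) ^ n) Filter.atTop
      (nhds (valueAt (c : ℝ)⁻¹ G)) := by
  have hc' : (c : ℝ) ≠ 0 := by exact_mod_cast hc.ne'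
  have h1 := (hG.of_norm.hasSum.tendsto_sum_nat).comp (Filter.tendsto_add_atTop_nat 1)
  refine h1.congr fun n => ?_
  rw [eq_mul_mk_of_mul_eq h, div_eq_mul_inv, ← inv_pow, coeff_mul_mul_pow,
    Finset.Nat.sum_antidiagonal_eq_sum_range_succ_mk]
  refine Finset.sum_congr rfl fun i _ => ?_
  rw [coeff_mk, Rat.cast_pow, inv_pow, inv_pow, mul_inv_cancel₀ (pow_ne_zero _ hc'), mul_one]

lemma valueAt_pos {z : ℝ} (hz : 0 < z) {F : PowerSeries ℚ} (hF : AbsConvergesAt z F)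
    (h0 : ∀ n, 0 ≤ coeff n F) (hne : F ≠ 0) : 0 < valueAt z F := by
  obtain ⟨n, hn⟩ : ∃ n, coeff n F ≠ 0 := by
    by_contra! H
    exact hne (ext (by simpa using H))
  refine Summable.tsum_pos hF.of_norm (fun i => ?_) n ?_
  · have : (0 : ℝ) ≤ (coeff i F : ℚ) := by exact_mod_cast h0 i
    positivity
  · have : (0 : ℝ) < (coeff n F : ℚ) := by exact_mod_cast (h0 n).lt_of_ne' hn
    positivity

lemma prime_one_sub_C_mul_X {c : ℚ} (hc : c ≠ 0) :
    Prime (1 - Polynomial.C c * Polynomial.X : Polynomial ℚ) := by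
  refine Polynomial.prime_of_degree_eq_one ?_
  rw [sub_eq_add_neg, add_comm, ← neg_mul, ← Polynomial.C_neg, ← Polynomial.C_1]
  exact Polynomial.degree_linear (neg_ne_zero.2 hc)

end PowerSeries

/-! ### Equating all the variables -/

namespace MvPowerSeries

/-- The substitution of `t` for all the variables. -/
noncomputable def diagonal (k : ℕ) : MvPowerSeries (Fin k) ℚ →ₐ[ℚ] PowerSeries ℚ :=
  substAlgHom (R := ℚ) (a := fun _ : Fin k => (PowerSeries.X : PowerSeries ℚ))
    (hasSubst_of_constantCoeff_zero fun _ => PowerSeries.constantCoeff_X)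

lemma diagonal_apply {k : ℕ} (F : MvPowerSeries (Fin k) ℚ) :
    diagonal k F = subst (fun _ : Fin k => (PowerSeries.X : PowerSeries ℚ)) F :=
  substAlgHom_apply _ _

lemma coeff_diagonal {k : ℕ} (F : MvPowerSeries (Fin k) ℚ) (n : ℕ) :
    PowerSeries.coeff n (diagonal k F) =
      ∑ m ∈ Finset.finsuppAntidiag (Finset.univ : Finset (Fin k)) n, coeff m F := by
  rw [diagonal_apply, PowerSeries.coeff, coeff_subst
    (hasSubst_of_constantCoeff_zero fun _ => PowerSeries.constantCoeff_X)]
  have h : ∀ m : Fin k →₀ ℕ, coeff m F • coeff (Finsupp.single () n)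
      (m.prod fun _ e => (PowerSeries.X : PowerSeries ℚ) ^ e) =
        if m ∈ Finset.finsuppAntidiag (Finset.univ : Finset (Fin k)) n then coeff m F else 0 := by
    intro m
    have : (m.prod fun _ e => (PowerSeries.X : PowerSeries ℚ) ^ e) =
        PowerSeries.X ^ (∑ i, m i) := by
      rw [Finsupp.prod_fintype _ _ (by simp), Finset.prod_pow_eq_pow_sum]
    rw [this]
    change coeff m F • PowerSeries.coeff n _ = _
    rw [PowerSeries.coeff_X_pow]
    simp [Finset.mem_finsuppAntidiag, eq_comm]
  simp only [h]
  rw [finsum_eq_sum_of_support_subset _ (s := Finset.finsuppAntidiag Finset.univ n)]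
  · exact Finset.sum_congr rfl fun m hm => if_pos hm
  · intro m hm
    by_contra H
    exact hm (if_neg H)

lemma diagonal_coe {k : ℕ} (N : MvPolynomial (Fin k) ℚ) :
    diagonal k (N : MvPowerSeries (Fin k) ℚ) =
      (MvPolynomial.aeval (fun _ : Fin k => (Polynomial.X : Polynomial ℚ)) N : Polynomial ℚ) := by
  rw [diagonal, substAlgHom_coe]
  induction N using MvPolynomial.induction_on with
  | C a => simp
  | add p q hp hq => rw [map_add, map_add, Polynomial.coe_add, hp, hq]
  | mul_X p i hp => simp [hp]

lemma aeval_oneSubSum {k : ℕ} (S : Finset (Fin k)) :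
    MvPolynomial.aeval (fun _ : Fin k => (Polynomial.X : Polynomial ℚ))
      (MvPolynomial.oneSubSum S) = 1 - Polynomial.C (S.card : ℚ) * Polynomial.X := by
  simp [MvPolynomial.oneSubSum]

end MvPowerSeries

/-! ### The recursion for the generating functions -/

namespace StanleyPoset

open MvPolynomial (oneSubSum)

variable {d : ℕ}

/-- The product of the generating function with `1 - x_1 - ⋯ - x_k`. -/
noncomputable def reducedGenFun (α : StanleyPoset d) (k : ℕ) : MvPowerSeries (Fin k) ℚ :=
  genFun α k * ((oneSubSum Finset.univ : MvPolynomial (Fin k) ℚ) : MvPowerSeries (Fin k) ℚ)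

lemma finite_chainsTo_withExponent (α : StanleyPoset d) (k : ℕ) (m : Fin k →₀ ℕ) :
    (chainsTo α (withExponent d k m)).Finite :=
  finite_chainsTo α (N := ∑ i, m i) fun P hP => by
    rw [weight_eq_sum_exponent hP.1, hP.2]

lemma finite_chainsTo_predBy (α : StanleyPoset d) {k : ℕ} (m : Fin (k + 1) →₀ ℕ)
    (o : Fin (k + 1) ⊕ Unit ⊕ Fin k × Fin (d - 1)) : (chainsTo α (predBy d m o)).Finite :=
  finite_chainsTo α (N := ∑ i, m i) fun P hP => by
    have h : P ∈ predecessors (withExponent d (k + 1) m) := by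
      rw [predecessors_withExponent]
      exact Set.mem_iUnion.2 ⟨o, hP⟩
    obtain ⟨Q, hQ, hs⟩ := h
    have := hs.weight_eq
    rw [weight_eq_sum_exponent hQ.1, hQ.2] at this
    omega

lemma card_chainsTo_and (α : StanleyPoset d) (c : Prop) [Decidable c] (X : Set (StanleyPoset d)) :
    Nat.card (chainsTo α {P | c ∧ P ∈ X}) = if c then Nat.card (chainsTo α X) else 0 := by
  split_ifs with h <;> simp [h, chainsTo]

lemma coeff_reducedGenFun (α : StanleyPoset d) (k : ℕ) (m : Fin (k + 1) →₀ ℕ)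
    [Decidable (α ∈ withExponent d (k + 1) m)] :
    MvPowerSeries.coeff m (reducedGenFun α (k + 1)) =
      (if α ∈ withExponent d (k + 1) m then 1 else 0) +
      ((if m 0 = 1 then MvPowerSeries.coeff (removeCoord 0 m) (genFun α k) else 0) +
      ∑ p : Fin k × Fin (d - 1), if m p.1.succ = p.2 + 1 ∧ 2 ≤ m p.1.castSucc then
        MvPowerSeries.coeff (removeCoord p.1.succ m + Finsupp.single p.1 (p.2 : ℕ)) (genFun α k)
        else 0) := by
  have h := card_chainsTo_eq_add α (subsingleton_withExponent (d := d) (k + 1) m)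
  rw [predecessors_withExponent, card_chainsTo_iUnion α (pairwise_disjoint_predBy m)
    (finite_chainsTo_predBy α m), Fintype.sum_sum_type, Fintype.sum_sum_type] at h
  simp only [predBy, card_chainsTo_and, Finset.univ_unique, Finset.sum_singleton] at h
  have h' := congrArg (Nat.cast (R := ℚ)) h
  push_cast at h'
  simp only [← genFun_eq_card_chainsTo] at h'
  rw [reducedGenFun, MvPowerSeries.coe_oneSubSum, mul_sub, mul_one, map_sub, h', Finset.mul_sum,
    map_sum]
  have hX : ∀ j : Fin (k + 1), MvPowerSeries.coeff m (genFun α (k + 1) * MvPowerSeries.X j) =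
      if 1 ≤ m j then MvPowerSeries.coeff (m - Finsupp.single j 1) (genFun α (k + 1)) else 0 := by
    intro j
    rw [MvPowerSeries.X, MvPowerSeries.coeff_mul_monomial, mul_one]
    simp only [Finsupp.single_le_iff]
  rw [Finset.sum_congr rfl fun j _ => hX j]
  ring

lemma coeff_genFun_nonneg (α : StanleyPoset d) (k : ℕ) (m : Fin k →₀ ℕ) :
    0 ≤ MvPowerSeries.coeff m (genFun α k) := by
  rw [genFun_eq_card_chainsTo]
  positivity

lemma coeff_reducedGenFun_nonneg (α : StanleyPoset d) {k : ℕ} (hk : 1 ≤ k)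
    (m : Fin k →₀ ℕ) :
    0 ≤ MvPowerSeries.coeff m (reducedGenFun α k) := by
  classical
  obtain ⟨k, rfl⟩ := Nat.exists_eq_add_of_le' hk
  rw [coeff_reducedGenFun]
  refine add_nonneg ?_ (add_nonneg ?_ (Finset.sum_nonneg fun p _ => ?_)) <;> split_ifs <;>
    first | exact le_rfl | exact zero_le_one | exact coeff_genFun_nonneg _ _ _

lemma genFun_ne_zero {α : StanleyPoset d} {k : ℕ} (h : α.width ≤ k) : genFun α k ≠ 0 := by
  classical
  induction k, h using Nat.le_induction with
  | base =>
    intro h0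
    have h1 := genFun_eq_card_chainsTo α α.width (exponent _ α)
    rw [h0, card_chainsTo_eq_add α (subsingleton_withExponent _ _),
      if_pos (show α ∈ withExponent d _ _ from ⟨rfl, rfl⟩)] at h1
    push_cast at h1
    have : (0 : ℚ) ≤ Nat.card (chainsTo α
      (predecessors (withExponent d α.width (exponent α.width α)))) := Nat.cast_nonneg _
    rw [map_zero] at h1
    linarith
  | succ k hk ih =>
    intro h0
    obtain ⟨m, hm⟩ : ∃ m, MvPowerSeries.coeff m (genFun α k) ≠ 0 := by
      by_contra! H
      exact ih (MvPowerSeries.ext (by simpa using H))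
    -- A chain of width `k` can be continued by `L`.
    have h1 := coeff_reducedGenFun α k (Finsupp.cons 1 m)
    have h2 : removeCoord 0 (Finsupp.cons 1 m) = m := by
      ext x
      rw [removeCoord_apply, Fin.zero_succAbove, Finsupp.cons_succ]
    rw [reducedGenFun, h0, zero_mul, map_zero, Finsupp.cons_zero, if_pos rfl, h2] at h1
    have h3 := (coeff_genFun_nonneg α k m).lt_of_ne' hm
    refine h1.not_lt (add_pos_of_nonneg_of_pos ?_ (add_pos_of_pos_of_nonneg h3
      (Finset.sum_nonneg fun p _ => ?_)))
    · split_ifs <;> norm_num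
    · split_ifs
      · exact coeff_genFun_nonneg _ _ _
      · exact le_rfl

/-- Decomposition of the chains of width `k + 1` according to their last step. The chain that
consists of `α` alone gives a monomial, the chains that end with an operation `U_j` give the
multiple of `f_{k+1}` on the left, and those that end with `L` or with some `V_i^r` come from chains
of width `k`. -/
lemma reducedGenFun_succ (α : StanleyPoset d) (k : ℕ) [Decidable (α.width = k + 1)] :
    reducedGenFun α (k + 1) =
      ((if α.width = k + 1 then MvPolynomial.monomial (exponent (k + 1) α) 1 else 0 :
        MvPolynomial (Fin (k + 1)) ℚ) : MvPowerSeries (Fin (k + 1)) ℚ) +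
      (MvPowerSeries.X 0 ^ 1 *
        MvPowerSeries.rename (Fin.succAboveEmb (0 : Fin (k + 1))) (genFun α k) +
      ∑ p : Fin k × Fin (d - 1), MvPowerSeries.X p.1.succ ^ (p.2 + 1 : ℕ) *
        MvPowerSeries.rename p.1.succ.succAboveEmb (MvPowerSeries.X p.1 ^ 2 *
          (MvPowerSeries.shift p.1)^[p.2 + 2] (genFun α k))) := by
  classical
  ext m
  rw [coeff_reducedGenFun, map_add, map_add, map_sum]
  congr 1
  · split_ifs with h1 h2 h2
    · rw [MvPolynomial.coeff_coe, MvPolynomial.coeff_monomial, if_pos h1.2]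
    · exact absurd h1.1 h2
    · rw [MvPolynomial.coeff_coe, MvPolynomial.coeff_monomial, if_neg fun h => h1 ⟨h2, h⟩]
    · rw [MvPolynomial.coe_zero, map_zero]
  · congr 1
    · rw [MvPowerSeries.coeff_X_pow_mul_rename_succAbove]
      rfl
    · refine Finset.sum_congr rfl fun p _ => ?_
      rw [MvPowerSeries.coeff_X_pow_mul_rename_succAbove,
        MvPowerSeries.coeff_X_sq_mul_shift_iterate, ite_and]
      have : (m.comapDomain p.1.succ.succAbove p.1.succ.succAbove_right_injective.injOn) p.1 =
          m p.1.castSucc := by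
        rw [Finsupp.comapDomain_apply]
        simp
      rw [this]
      rfl

open MvPowerSeries in
/-- The two assertions are proved together: for `k ≥ 1` the second gives the first, and the first for
`k` gives the second for `k + 1`, because the renamings of the variables leave out a variable. -/
lemma subsetRational_genFun (α : StanleyPoset d) (k : ℕ) :
    SubsetRational Set.univ (genFun α k) ∧
      (1 ≤ k → SubsetRational {S | S ≠ Finset.univ}
        (reducedGenFun α k)) := by
  classical
  induction k with
  | zero =>
    refine ⟨?_, by omega⟩
    have : genFun α 0 = (MvPolynomial.C (coeff 0 (genFun α 0)) : MvPolynomial (Fin 0) ℚ) := by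
      ext m
      rw [Subsingleton.elim m 0, MvPolynomial.coeff_coe, MvPolynomial.coeff_zero_C]
    exact this ▸ SubsetRational.coe _
  | succ k ih =>
    have hren : ∀ (a : Fin (k + 1)) (n : ℕ) {F : MvPowerSeries (Fin k) ℚ},
        SubsetRational Set.univ F → SubsetRational {S | S ≠ Finset.univ}
          (X a ^ n * MvPowerSeries.rename a.succAboveEmb F) := by
      intro a n F hF
      have := (hF.rename a.succAboveEmb (𝒯 := {S | S ≠ Finset.univ}) fun S _ h => ?_).coe_mul
        (MvPolynomial.X a ^ n)
      · simpa using this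
      · have : a ∈ S.map a.succAboveEmb := h ▸ Finset.mem_univ a
        obtain ⟨x, -, hx⟩ := Finset.mem_map.1 this
        exact Fin.succAbove_ne a x hx
    have h : SubsetRational {S | S ≠ Finset.univ}
        (reducedGenFun α (k + 1)) := by
      rw [reducedGenFun_succ]
      refine (SubsetRational.coe _).add ((hren _ _ ih.1).add (SubsetRational.sum _ fun p _ =>
        hren _ _ ?_))
      have := (ih.1.shift_iterate (a := p.1) (fun _ _ => Set.mem_univ _) (p.2 + 2)).coe_mul
        (MvPolynomial.X p.1 ^ 2)
      simpa using this
    refine ⟨SubsetRational.of_mul (Set.mem_univ Finset.univ)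
      (h.mono (Set.subset_univ _)), fun _ => h⟩

/-- The generating function is a quotient whose denominator is a product of powers of the
`1 - ∑ i ∈ S, x_i`, where the factor with all the variables occurs once. -/
lemma exists_genFun_mul_prod (α : StanleyPoset d) {k : ℕ} (hk : 1 ≤ k) :
    ∃ e : Finset (Fin k) → ℕ, ∃ N : MvPolynomial (Fin k) ℚ,
      reducedGenFun α k *
        ((∏ S ∈ Finset.univ.erase Finset.univ, oneSubSum S ^ e S : MvPolynomial (Fin k) ℚ) :
          MvPowerSeries (Fin k) ℚ) = N := by
  obtain ⟨e, he, N, h⟩ := ((subsetRational_genFun α k).2 hk).exists_mul_prod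
  refine ⟨e, N, ?_⟩
  rw [← h, ← Finset.mul_prod_erase Finset.univ _ (Finset.mem_univ Finset.univ),
    he _ (by simp), pow_zero, one_mul]

/-! ### The specialization and its pole at `1 / k` -/

lemma specialization_eq_diagonal (α : StanleyPoset d) (k : ℕ) :
    specialization α k = MvPowerSeries.diagonal k (genFun α k) :=
  (MvPowerSeries.diagonal_apply _).symm

lemma coeff_specialization (α : StanleyPoset d) (k n : ℕ) :
    PowerSeries.coeff n (α.specialization k) =
      if α.weight ≤ n then (α.chainCount k (n - α.weight) : ℚ) else 0 := by
  classical
  rw [specialization_eq_diagonal, MvPowerSeries.coeff_diagonal]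
  simp only [genFun_eq_card_chainsTo]
  rw [← Finset.sum_coe_sort (Finset.finsuppAntidiag Finset.univ n),
    ← Nat.cast_sum, ← card_chainsTo_iUnion α
      (A := fun m : Finset.finsuppAntidiag (Finset.univ : Finset (Fin k)) n =>
        withExponent d k m) ?_ fun m => finite_chainsTo_withExponent α k m]
  · have key : ∀ γ : SaturatedChain d, γ ∈ chainsTo α (⋃ m : Finset.finsuppAntidiag
        (Finset.univ : Finset (Fin k)) n, withExponent d k m) ↔
        γ ∈ chains α k ∧ α.weight + γ.length = n := by
      intro γ
      have h1 : γ.last.weight = γ.head.weight + γ.length := by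
        have := weight_chain γ (Fin.last _)
        rwa [Fin.val_last] at this
      constructor
      · rintro ⟨h2, h3⟩
        obtain ⟨⟨m, hm⟩, hw, hm'⟩ := Set.mem_iUnion.1 h3
        refine ⟨⟨h2, hw⟩, ?_⟩
        rw [← h2, ← h1, weight_eq_sum_exponent hw, hm']
        exact (Finset.mem_finsuppAntidiag.1 hm).1
      · rintro ⟨⟨h2, hw⟩, h3⟩
        refine ⟨h2, Set.mem_iUnion.2 ⟨⟨exponent k γ.last, ?_⟩, hw, rfl⟩⟩
        rw [Finset.mem_finsuppAntidiag]
        refine ⟨?_, Finset.subset_univ _⟩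
        rw [← h3, ← h2, ← h1, weight_eq_sum_exponent hw]
    split_ifs with hn
    · rw [chainCount]
      congr 1
      refine Nat.card_congr (Equiv.subtypeEquivRight fun γ => (key γ).trans ?_)
      exact and_congr_right fun _ => by omega
    · rw [Nat.cast_eq_zero, Nat.card_eq_zero]
      refine Or.inl ⟨fun γ => hn ?_⟩
      have := ((key γ.1).1 γ.2).2
      omega
  · intro m m' hm
    rw [Function.onFun, Set.disjoint_left]
    exact fun P h h' => hm (Subtype.ext (h.2.symm.trans h'.2))

/-- The numerator of `L_k^α` over the denominator `1 - k t`. -/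
noncomputable def diagonalNumerator (α : StanleyPoset d) (k : ℕ) : PowerSeries ℚ :=
  MvPowerSeries.diagonal k (reducedGenFun α k)

lemma specialization_mul (α : StanleyPoset d) (k : ℕ) :
    α.specialization k *
      ((1 - Polynomial.C (k : ℚ) * Polynomial.X : Polynomial ℚ) : PowerSeries ℚ) =
      diagonalNumerator α k := by
  rw [diagonalNumerator, reducedGenFun, map_mul, MvPowerSeries.diagonal_coe,
    MvPowerSeries.aeval_oneSubSum, specialization_eq_diagonal, Finset.card_univ, Fintype.card_fin]

lemma exists_diagonalNumerator_mul_prod (α : StanleyPoset d) {k : ℕ} (hk : 1 ≤ k) :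
    ∃ e : Finset (Fin k) → ℕ, ∃ N : Polynomial ℚ,
      diagonalNumerator α k * ((∏ S ∈ Finset.univ.erase Finset.univ,
        (1 - Polynomial.C (S.card : ℚ) * Polynomial.X) ^ e S : Polynomial ℚ) : PowerSeries ℚ) =
      N := by
  obtain ⟨e, N, h⟩ := exists_genFun_mul_prod α hk
  refine ⟨e, MvPolynomial.aeval (fun _ => Polynomial.X) N, ?_⟩
  rw [← MvPowerSeries.diagonal_coe, ← h, map_mul, ← diagonalNumerator,
    MvPowerSeries.diagonal_coe]
  simp only [map_prod, map_pow, MvPowerSeries.aeval_oneSubSum]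

lemma card_lt_of_mem_erase_univ {k : ℕ} {S : Finset (Fin k)}
    (hS : S ∈ (Finset.univ : Finset (Finset (Fin k))).erase Finset.univ) : S.card < k := by
  simpa using Finset.card_lt_univ_of_notMem (Classical.choose_spec
    (not_forall.1 fun h => Finset.ne_of_mem_erase hS (Finset.eq_univ_of_forall h)))

/-- The poles of the numerator are among the `1 / i` with `i < k`, so that it converges
at `1 / k`. -/
lemma absConvergesAt_diagonalNumerator (α : StanleyPoset d) {k : ℕ} (hk : 1 ≤ k) :
    (diagonalNumerator α k).AbsConvergesAt ((k : ℚ) : ℝ)⁻¹ := by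
  obtain ⟨e, N, h⟩ := exists_diagonalNumerator_mul_prod α hk
  refine PowerSeries.AbsConvergesAt.of_mul_prod _ (fun S : Finset (Fin k) => (S.card : ℚ)) e
    (fun S hS => ?_) (h ▸ PowerSeries.absConvergesAt_coe _ N)
  have h1 : (S.card : ℝ) < k := by exact_mod_cast card_lt_of_mem_erase_univ hS
  have h2 : (0 : ℝ) < k := by exact_mod_cast hk
  rw [Real.norm_of_nonneg (by positivity)]
  push_cast
  rwa [← div_eq_mul_inv, div_lt_one h2]

lemma valueAt_diagonalNumerator_pos {α : StanleyPoset d} {k : ℕ} (hk : 1 ≤ k)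
    (hα : α.width ≤ k) : 0 < (diagonalNumerator α k).valueAt ((k : ℚ) : ℝ)⁻¹ := by
  have h2 : (0 : ℝ) < (k : ℚ) := by exact_mod_cast hk
  refine PowerSeries.valueAt_pos (inv_pos.2 h2) (absConvergesAt_diagonalNumerator α hk)
    (fun n => ?_) fun h0 => ?_
  · rw [diagonalNumerator, MvPowerSeries.coeff_diagonal]
    exact Finset.sum_nonneg fun m _ => coeff_reducedGenFun_nonneg α hk m
  · have hne : reducedGenFun α k ≠ 0 := by
      refine mul_ne_zero (genFun_ne_zero hα) ?_
      rw [Ne, MvPolynomial.coe_eq_zero_iff]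
      exact MvPolynomial.oneSubSum_ne_zero _
    obtain ⟨m, hm⟩ : ∃ m, MvPowerSeries.coeff m (reducedGenFun α k) ≠ 0 := by
      by_contra! H
      exact hne (MvPowerSeries.ext (by simpa using H))
    have h1 := congrArg (PowerSeries.coeff (∑ i, m i)) h0
    rw [diagonalNumerator, MvPowerSeries.coeff_diagonal, map_zero,
      Finset.sum_eq_zero_iff_of_nonneg fun m _ => coeff_reducedGenFun_nonneg α hk m] at h1
    exact hm (h1 m (by simp [Finset.mem_finsuppAntidiag]))

/-- The pole of `L_k^α` at `1 / k` is present in every representation as a quotient, because the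
numerator is positive there. -/
lemma not_dvd_of_specialization_mul {α : StanleyPoset d} {k : ℕ} (hk : 1 ≤ k)
    (hα : α.width ≤ k) {Q N : Polynomial ℚ} (hQ : Polynomial.aeval ((k : ℚ) : ℝ)⁻¹ Q ≠ 0)
    (h : α.specialization k * (((1 - Polynomial.C (k : ℚ) * Polynomial.X) * Q : Polynomial ℚ) :
      PowerSeries ℚ) = N) :
    ¬ (1 - Polynomial.C (k : ℚ) * Polynomial.X) ∣ N := by
  rintro ⟨M, rfl⟩
  have h2 : ((k : ℚ) : ℝ) ≠ 0 := by
    have : k ≠ 0 := by omega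
    exact_mod_cast this
  rw [Polynomial.coe_mul, ← mul_assoc, specialization_mul] at h
  have h1 := congrArg (PowerSeries.valueAt ((k : ℚ) : ℝ)⁻¹) h
  rw [PowerSeries.valueAt_mul (absConvergesAt_diagonalNumerator α hk)
    (PowerSeries.absConvergesAt_coe _ _), PowerSeries.valueAt_coe, PowerSeries.valueAt_coe,
    map_mul] at h1
  have h0 : Polynomial.aeval ((k : ℚ) : ℝ)⁻¹ (1 - Polynomial.C (k : ℚ) * Polynomial.X) = 0 := by
    rw [map_sub, map_mul, map_one, Polynomial.aeval_C, Polynomial.aeval_X]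
    change 1 - ((k : ℚ) : ℝ) * _ = 0
    rw [mul_inv_cancel₀ h2, sub_self]
  rw [h0, zero_mul] at h1
  exact mul_ne_zero (valueAt_diagonalNumerator_pos hk hα).ne' hQ h1

lemma aeval_prod_ne_zero {I : Type*} {k : ℕ} (hk : 1 ≤ k) (s : Finset I) (c e : I → ℕ)
    (hc : ∀ i ∈ s, c i < k) :
    Polynomial.aeval ((k : ℚ) : ℝ)⁻¹
      (∏ i ∈ s, (1 - Polynomial.C (c i : ℚ) * Polynomial.X) ^ e i) ≠ 0 := by
  rw [map_prod, Finset.prod_ne_zero_iff]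
  intro i hi
  rw [map_pow, map_sub, map_mul, map_one, Polynomial.aeval_C, Polynomial.aeval_X]
  refine pow_ne_zero _ (sub_ne_zero.2 (ne_of_gt ?_))
  have h1 : (c i : ℝ) < k := by exact_mod_cast hc i hi
  have h2 : (0 : ℝ) < k := by exact_mod_cast hk
  change ((c i : ℚ) : ℝ) * _ < 1
  push_cast
  rwa [← div_eq_mul_inv, div_lt_one h2]

/-! ### Denominators -/

lemma exists_genFun_hasDenominator {α : StanleyPoset d} {k : ℕ} (hk : 1 ≤ k)
    (hα : α.width ≤ k) :
    ∃ e : Finset (Fin k) → ℕ, e Finset.univ = 1 ∧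
      (α.genFun k).HasDenominator
        (∏ S ∈ (Finset.univ : Finset (Finset (Fin k))).erase ∅, oneSubSum S ^ e S) := by
  classical
  have hne : (Finset.univ : Finset (Fin k)) ≠ ∅ := by
    have : NeZero k := ⟨by omega⟩
    exact Finset.univ_nonempty.ne_empty
  have hmem : Finset.univ ∈ (Finset.univ : Finset (Finset (Fin k))).erase ∅ :=
    Finset.mem_erase.2 ⟨hne, Finset.mem_univ _⟩
  refine (exists_isRelPrime_prod_pow
    (φ := MvPolynomial.coeToMvPowerSeries.ringHom (σ := Fin k) (R := ℚ))
    (MvPolynomial.coe_injective (Fin k) ℚ)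
    (s := (Finset.univ : Finset (Finset (Fin k))).erase ∅) (l := oneSubSum)
    (fun S hS => MvPolynomial.prime_oneSubSum
      (Finset.nonempty_iff_ne_empty.2 (Finset.ne_of_mem_erase hS)))
    (u := Finset.univ) (f := genFun α k) ?_ ?_).imp fun e ⟨he, N, hN, h⟩ =>
      ⟨he, Finset.prod_ne_zero_iff.2 fun S _ => pow_ne_zero _
        (MvPolynomial.oneSubSum_ne_zero S), N, hN, h⟩
  · obtain ⟨e, N, h⟩ := exists_genFun_mul_prod α hk
    refine ⟨Function.update e Finset.univ 1, by simp, N, ?_⟩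
    rw [MvPolynomial.coeToMvPowerSeries.ringHom_apply,
      MvPolynomial.coeToMvPowerSeries.ringHom_apply, ← h, reducedGenFun, mul_assoc, ← MvPolynomial.coe_mul,
      Finset.prod_erase _ (by simp),
      ← Finset.mul_prod_erase Finset.univ _ (Finset.mem_univ Finset.univ),
      Function.update_self, pow_one]
    congr 3
    exact Finset.prod_congr rfl fun S hS => by
      rw [Function.update_of_ne (Finset.ne_of_mem_erase hS)]
  · rintro e N he h ⟨M, rfl⟩
    rw [MvPolynomial.coeToMvPowerSeries.ringHom_apply,
      MvPolynomial.coeToMvPowerSeries.ringHom_apply, ← Finset.mul_prod_erase _ _ hmem, he,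
      pow_one] at h
    have h1 := congrArg (MvPowerSeries.diagonal k) h
    rw [map_mul, MvPowerSeries.diagonal_coe, MvPowerSeries.diagonal_coe, map_mul, map_mul,
      MvPowerSeries.aeval_oneSubSum, Finset.card_univ, Fintype.card_fin,
      ← specialization_eq_diagonal] at h1
    simp only [map_prod, map_pow, MvPowerSeries.aeval_oneSubSum] at h1
    refine not_dvd_of_specialization_mul hk hα (aeval_prod_ne_zero hk _ _ _ fun S hS => ?_) h1
      ⟨_, rfl⟩
    exact card_lt_of_mem_erase_univ
      (Finset.mem_erase.2 ⟨Finset.ne_of_mem_erase hS, Finset.mem_univ _⟩)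

lemma exists_specialization_hasDenominator {α : StanleyPoset d} {k : ℕ} (hk : 1 ≤ k)
    (hα : α.width ≤ k) :
    ∃ c : ℕ → ℕ, c k = 1 ∧
      (α.specialization k).HasDenominator
        (∏ i ∈ Finset.Icc 1 k, (1 - Polynomial.C (i : ℚ) * Polynomial.X) ^ c i) := by
  classical
  have hmem : k ∈ Finset.Icc 1 k := Finset.mem_Icc.2 ⟨hk, le_rfl⟩
  have hprime : ∀ i ∈ Finset.Icc 1 k,
      Prime (1 - Polynomial.C (i : ℚ) * Polynomial.X : Polynomial ℚ) := fun i hi =>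
    PowerSeries.prime_one_sub_C_mul_X (by
      have := (Finset.mem_Icc.1 hi).1
      exact_mod_cast (by omega : i ≠ 0))
  refine (exists_isRelPrime_prod_pow
    (φ := Polynomial.coeToPowerSeries.ringHom (R := ℚ)) (Polynomial.coe_injective ℚ)
    hprime (u := k) (f := specialization α k) ?_ ?_).imp fun c ⟨hc, N, hN, h⟩ =>
      ⟨hc, Finset.prod_ne_zero_iff.2 fun i hi => pow_ne_zero _ (hprime i hi).ne_zero, N, hN, h⟩
  · obtain ⟨e, N, h⟩ := exists_diagonalNumerator_mul_prod α hk
    -- The factors with the same number of variables are merged by the specialization.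
    set c : ℕ → ℕ := fun i => ∑ S ∈ (Finset.univ.erase Finset.univ : Finset (Finset (Fin k))) with
      S.card = i, e S with hc
    refine ⟨Function.update c k 1, by simp, N, ?_⟩
    rw [Polynomial.coeToPowerSeries.ringHom_apply, Polynomial.coeToPowerSeries.ringHom_apply, ← h,
      ← specialization_mul, mul_assoc, ← Polynomial.coe_mul,
      ← Finset.mul_prod_erase _ _ hmem, Function.update_self, pow_one]
    congr 3
    have h1 : ∏ i ∈ (Finset.Icc 1 k).erase k,
        (1 - Polynomial.C (i : ℚ) * Polynomial.X : Polynomial ℚ) ^ Function.update c k 1 i =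
        ∏ i ∈ Finset.range k, (1 - Polynomial.C (i : ℚ) * Polynomial.X) ^ c i := by
      have : (Finset.Icc 1 k).erase k = (Finset.range k).erase 0 := by
        ext i
        simp only [Finset.mem_erase, Finset.mem_Icc, Finset.mem_range]
        omega
      rw [← Finset.prod_erase (Finset.range k) (a := 0) (by simp), ← this]
      exact Finset.prod_congr rfl fun i hi => by
        rw [Function.update_of_ne (Finset.ne_of_mem_erase hi)]
    rw [h1, ← Finset.prod_fiberwise_of_maps_to (t := Finset.range k) (g := Finset.card)
      (fun S hS => Finset.mem_range.2 (card_lt_of_mem_erase_univ hS))]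
    refine Finset.prod_congr rfl fun i _ => ?_
    rw [hc, ← Finset.prod_pow_eq_pow_sum]
    exact Finset.prod_congr rfl fun S hS => by rw [(Finset.mem_filter.1 hS).2]
  · intro c N hc h
    rw [Polynomial.coeToPowerSeries.ringHom_apply, Polynomial.coeToPowerSeries.ringHom_apply,
      ← Finset.mul_prod_erase _ _ hmem, hc, pow_one] at h
    refine not_dvd_of_specialization_mul hk hα (aeval_prod_ne_zero hk _ _ _ fun i hi => ?_) h
    have := (Finset.mem_Icc.1 (Finset.mem_of_mem_erase hi)).2
    exact lt_of_le_of_ne this (Finset.ne_of_mem_erase hi)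

/-! ### Asymptotics -/

lemma isEquivalent_mul_pow {u : ℕ → ℝ} {k : ℕ} (hk : 1 ≤ k) {C : ℝ} (hC : 0 < C)
    (h : Filter.Tendsto (fun n => u n / (k : ℝ) ^ n) Filter.atTop (nhds C)) :
    Asymptotics.IsEquivalent Filter.atTop u fun n => C * (k : ℝ) ^ n := by
  have hk' : (k : ℝ) ≠ 0 := by exact_mod_cast (by omega : k ≠ 0)
  refine (Asymptotics.isEquivalent_iff_tendsto_one (Filter.Eventually.of_forall fun n =>
    mul_ne_zero hC.ne' (pow_ne_zero _ hk'))).2 ?_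
  have h1 := h.div_const C
  rw [div_self hC.ne'] at h1
  refine h1.congr fun n => ?_
  rw [Pi.div_apply, div_div, mul_comm]

lemma tendsto_coeff_specialization (α : StanleyPoset d) {k : ℕ} (hk : 1 ≤ k) :
    Filter.Tendsto (fun n => ((PowerSeries.coeff n (α.specialization k) : ℚ) : ℝ) / (k : ℝ) ^ n)
      Filter.atTop (nhds ((diagonalNumerator α k).valueAt ((k : ℚ) : ℝ)⁻¹)) := by
  have := PowerSeries.tendsto_coeff_div_pow (c := k) (by exact_mod_cast hk)
    (specialization_mul α k) (absConvergesAt_diagonalNumerator α hk)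
  simpa only [Rat.cast_natCast] using this

end StanleyPoset

open StanleyPoset in
theorem mainTheorem5 (d k : ℕ) (hd : 1 ≤ d) (hk : 1 ≤ k) (α : StanleyPoset d)
    (hα : α.width ≤ k) :
    (∃ e : Finset (Fin k) → ℕ, e Finset.univ = 1 ∧
      (α.genFun k).HasDenominator
        (∏ S ∈ (Finset.univ : Finset (Finset (Fin k))).erase ∅,
          (1 - ∑ i ∈ S, MvPolynomial.X i) ^ e S)) ∧
    (∃ c : ℕ → ℕ, c k = 1 ∧
      (α.specialization k).HasDenominator
        (∏ i ∈ Finset.Icc 1 k, (1 - Polynomial.C (i : ℚ) * Polynomial.X) ^ c i)) ∧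
    (∀ n : ℕ, PowerSeries.coeff n (α.specialization k) =
      if α.weight ≤ n then (α.chainCount k (n - α.weight) : ℚ) else 0) ∧
    (∃ C : ℝ, 0 < C ∧ Asymptotics.IsEquivalent Filter.atTop
      (fun n : ℕ => ((PowerSeries.coeff n (α.specialization k) : ℚ) : ℝ))
      (fun n : ℕ => C * (k : ℝ) ^ n)) ∧
    (∃ C : ℝ, 0 < C ∧ Asymptotics.IsEquivalent Filter.atTop
      (fun n : ℕ => (α.chainCount k n : ℝ)) (fun n : ℕ => C * (k : ℝ) ^ n)) := by
  have hk' : (0 : ℝ) < k := by exact_mod_cast hk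
  have hpos := valueAt_diagonalNumerator_pos hk hα
  have hlim := tendsto_coeff_specialization α hk
  refine ⟨exists_genFun_hasDenominator hk hα, exists_specialization_hasDenominator hk hα,
    coeff_specialization α k, ⟨_, hpos, isEquivalent_mul_pow hk hpos hlim⟩,
    ⟨_, mul_pos hpos (pow_pos hk' α.weight), isEquivalent_mul_pow hk
      (mul_pos hpos (pow_pos hk' α.weight)) ?_⟩⟩
  refine ((hlim.comp (Filter.tendsto_add_atTop_nat α.weight)).mul_const _).congr fun n => ?_
  rw [Function.comp_apply, coeff_specialization, if_pos (by omega), Nat.add_sub_cancel, pow_add]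
  push_cast
  field_simp
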